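/- Let $0<\epsilon<\pi/4$. Let $(\tau_v)_{v\in\mathbb Z^2}$ be i.i.d. Exp$(1)$ random variables and let $(\theta_v)_{v\in\mathbb Z^2}$ be i.i.d. random variables, uniform on $(\epsilon,\pi/2-\epsilon)$, such that the two families are independent of each other. An up-right path is a finite or infinite sequence of points of $\mathbb Z^2$ whose consecutive differences lie in $\{(1,0),(0,1)\}$. The weight of a finite up-right path from $u$ to $v$ is the sum of $\tau_w$ over all its vertices $w$ other than $u$ and $v$; the path is called a geodesic if its weight is maximal among all up-right paths from $u$ to $v$. A semi-infinite geodesic from $u$ is an infinite up-right path $u_0=u,u_1,u_2,\dots$ all of whose finite segments are geodesics, and it has direction $\theta$ if $u_n/|u_n|\to(\cos\theta,\sin\theta)$ as $n\to\infty$, where $|\cdot|$ is the Euclidean norm. For a fixed direction $\theta\in(0,\pi/2)$, almost surely there is exactly one semi-infinite geodesic in direction $\theta$ from every $u\in\mathbb Z^2$; denote it by $\Gamma_u^{\theta}$. Let $$N:=\bigl|\{u\in\mathbb Z^2:\ (0,0)\in\Gamma_u^{\theta_u}\}\bigr|\in\{0,1,2,\dots\}\cup\{\infty\}$$ be the number of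 cars passing through the origin, where from every $u\in\mathbb Z^2$ one car starts and follows $\Gamma_u^{\theta_u}$. Then $\mathbb E(N)=\infty$. -/

import Mathlib

open MeasureTheory ProbabilityTheory Filter Topology
open scoped ENNReal

namespace RoadLayout

/-- `q` is reached from `p` by one up or right step of the lattice `ℤ²`. -/
def IsStep (p q : ℤ × ℤ) : Prop :=
  q = p + (1, 0) ∨ q = p + (0, 1)

/-- The vertices `γ 0, γ 1, …, γ n` form a finite up-right path (with `n` steps) from `u` to `v`.
The values of `γ` after `n` are irrelevant. -/
structure IsUpRightPath (u v : ℤ × ℤ) (n : ℕ) (γ : ℕ → ℤ × ℤ) : Prop where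
  start : γ 0 = u
  finish : γ n = v
  step : ∀ k < n, IsStep (γ k) (γ (k + 1))

/-- The weight of the path `γ 0, …, γ n`: the sum of the vertex weights
over all vertices of the path except its two end points. -/
def pathWeight (τ : ℤ × ℤ → ℝ) (n : ℕ) (γ : ℕ → ℤ × ℤ) : ℝ :=
  ∑ k ∈ Finset.Ioo 0 n, τ (γ k)

/-- `γ 0, …, γ n` is a (point-to-point) geodesic from `u` to `v`: an up-right path from `u` to `v`
that has the maximal weight among all up-right paths from `u` to `v`. -/
def IsGeodesic (τ : ℤ × ℤ → ℝ) (u v : ℤ × ℤ) (n : ℕ) (γ : ℕ → ℤ × ℤ) : Prop :=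
  IsUpRightPath u v n γ ∧
    ∀ (n' : ℕ) (γ' : ℕ → ℤ × ℤ), IsUpRightPath u v n' γ' →
      pathWeight τ n' γ' ≤ pathWeight τ n γ

/-- `γ 0, γ 1, γ 2, …` is a semi-infinite geodesic starting from `u`: an infinite up-right path
all of whose finite segments `γ m, …, γ (m + n)` are geodesics. -/
structure IsSemiInfiniteGeodesic (τ : ℤ × ℤ → ℝ) (u : ℤ × ℤ) (γ : ℕ → ℤ × ℤ) : Prop where
  start : γ 0 = u
  step : ∀ k, IsStep (γ k) (γ (k + 1))
  geodesic : ∀ m n : ℕ, IsGeodesic τ (γ m) (γ (m + n)) n (fun k => γ (m + k))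

/-- The unit vectors `γ n / |γ n|` (Euclidean norm) converge to `(cos α, sin α)`. -/
def HasDirection (γ : ℕ → ℤ × ℤ) (α : ℝ) : Prop :=
  Tendsto
    (fun n : ℕ =>
      (((γ n).1 : ℝ) / √(((γ n).1 : ℝ) ^ 2 + ((γ n).2 : ℝ) ^ 2),
       ((γ n).2 : ℝ) / √(((γ n).1 : ℝ) ^ 2 + ((γ n).2 : ℝ) ^ 2)))
    atTop (𝓝 (Real.cos α, Real.sin α))

/-- In the environment `τ`, the car that starts at `u` and drives in direction `α` passes through
`v`, i.e. `v` lies on the semi-infinite geodesic from `u` in direction `α`. (For fixed `u` and `α`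
there is almost surely exactly one such geodesic in the exponential environment.) -/
def CarPasses (τ : ℤ × ℤ → ℝ) (u : ℤ × ℤ) (α : ℝ) (v : ℤ × ℤ) : Prop :=
  ∃ γ : ℕ → ℤ × ℤ, IsSemiInfiniteGeodesic τ u γ ∧ HasDirection γ α ∧ ∃ k, γ k = v

/-- The number `N ∈ {0, 1, 2, …, ∞}` of cars that pass through the origin, when the car at each
vertex `u` drives in direction `θ u`. -/
noncomputable def numCars (τ θ : ℤ × ℤ → ℝ) : ℕ∞ :=
  Set.encard {u : ℤ × ℤ | CarPasses τ u (θ u) (0, 0)}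

end RoadLayout

/-!
The expected number of cars through the origin is computed by mass transport. The environment and
angle seen from a vertex have the same law for every vertex, so the probability that the car from
`-v` passes through the origin is at least the probability `P (E v)` that there is a geodesic from
the origin, in the random direction of its car, through `v`. Whenever a semi-infinite geodesic in
this direction exists at all, it has infinitely many vertices, so `∑ v, P (E v) = ∞` as soon as such
a geodesic exists with positive probability. Neither uniqueness nor coalescence is needed.

Existence is obtained from Burke's property of stationary last-passage percolation. On the quadrant
`ℕ²` put i.i.d. boundary increments `Exp(p)` on horizontal and `Exp(q)` on vertical edges, with
`p + q = 1`, and i.i.d. `Exp(1)` bulk weights. The map that computes the increments on the far sides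
of a unit square from those on its near sides, together with the dual weight `min I J`, preserves
the product law (`measurePreserving_corner`). Running it along a column, and then running the
columns one after another, shows that the dual weights are i.i.d. `Exp(1)`
(`measurePreserving_dualWeight`); both times this is the general fact that a stationary transducer
turns i.i.d. inputs into i.i.d. outputs (`measurePreserving_runOut`). The last-passage time
`height` increases along every up-right path by at least the dual weights and, along the walk
`greedy` that always follows the smaller increment, by exactly the dual weights. So the greedy walk
is a semi-infinite geodesic of the i.i.d. environment of dual weights
(`isGeodesicWalk_greedySteps`).

Its direction is deterministic. The weight of the greedy walk up to `x` equals the height of the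
model with parameters `p, q`, about `x₁ / p + x₂ / q`. But path weights to `x` in an i.i.d.
environment are at most about `x₁ / p' + x₂ / q'` for all other parameters `p' + q' = 1`, by the same
comparison in the model with those parameters. This leaves only the direction `(p², q²)`
(`ae_tendsto_greedy`); the errors are controlled by Chernoff bounds and the Borel–Cantelli lemma.

The geodesic so constructed depends on the whole stationary model, not only on the dual weights.
To transfer its existence to the given weights, Egorov's theorem provides a deterministic rate of
convergence to the direction, uniform in the random angle, with probability at least `1 / 2`. The
existence of a geodesic with this rate is a closed condition on the weights and the angle, because
the space of step sequences `ℕ → Bool` is compact, and hence its probability only depends on their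
joint law (`exists_measure_isDirectedGeodesicWalk_pos`).
-/

namespace RoadLayout

/-! ### Exponential laws and the corner map -/

lemma expMeasure_eq_withDensity (r : ℝ) :
    expMeasure r = volume.withDensity (exponentialPDF r) := rfl

lemma measurable_exponentialPDF (r : ℝ) : Measurable (exponentialPDF r) :=
  (measurable_exponentialPDFReal r).ennreal_ofReal

lemma measurePreserving_div_expMeasure {r : ℝ} (hr : 0 < r) :
    MeasurePreserving (fun x : ℝ => x / r) (expMeasure 1) (expMeasure r) := by
  refine ⟨by fun_prop, ?_⟩
  have := isProbabilityMeasure_expMeasure hr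
  have := isProbabilityMeasure_expMeasure one_pos
  have : IsProbabilityMeasure ((expMeasure 1).map (fun x : ℝ => x / r)) :=
    Measure.isProbabilityMeasure_map (by fun_prop)
  apply Measure.eq_of_cdf
  ext x
  rw [cdf_expMeasure_eq hr, cdf_eq_real, measureReal_def,
    Measure.map_apply (by fun_prop) measurableSet_Iic]
  have : (fun x : ℝ => x / r) ⁻¹' Set.Iic x = Set.Iic (r * x) := by
    ext y
    simp [div_le_iff₀' hr]
  rw [this, ← measureReal_def, ← cdf_eq_real, cdf_expMeasure_eq one_pos]
  simp [mul_nonneg_iff_of_pos_left hr]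

/-- The corner map of exponential last-passage percolation: from the increments `I`, `J` on the
south and west edges of a unit square and the weight `w` of its north-east vertex it computes the
increments on the north and east edges, together with the dual weight `min I J`. -/
def corner (z : ℝ × ℝ × ℝ) : ℝ × ℝ × ℝ :=
  (z.2.2 + max (z.1 - z.2.1) 0, z.2.2 + max (z.2.1 - z.1) 0, min z.1 z.2.1)

lemma measurable_corner : Measurable corner := by
  unfold corner; fun_prop

/-- In the coordinates `J - I`, `min I J`, `w` the corner map interchanges `min I J` and `w`, and
both changes of coordinates are compositions of shears. -/
lemma measurePreserving_corner_volume : MeasurePreserving corner volume volume := by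
  have h1 : MeasurePreserving (fun z : ℝ × ℝ × ℝ => (z.1, (z.2.1 - z.1, z.2.2)))
      volume volume := by
    refine (MeasurePreserving.id (volume : Measure ℝ)).skew_product
      (g := fun (a : ℝ) (z : ℝ × ℝ) => (z.1 - a, z.2)) (by fun_prop) (.of_forall fun a => ?_)
    exact ((measurePreserving_sub_right volume a).prod (MeasurePreserving.id volume)).map_eq
  have h2 : MeasurePreserving (fun z : (ℝ × ℝ) × ℝ => (z.1, z.2 + min 0 z.1.1))
      volume volume := by
    refine (MeasurePreserving.id (volume : Measure (ℝ × ℝ))).skew_product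
      (g := fun a z => z + min 0 a.1) (by fun_prop) (.of_forall fun a => ?_)
    exact (measurePreserving_add_right volume _).map_eq
  have h3 : MeasurePreserving (fun z : ℝ × ℝ × ℝ => (z.1, (z.2.1 - min 0 z.1, z.2.2)))
      volume volume := by
    refine (MeasurePreserving.id (volume : Measure ℝ)).skew_product
      (g := fun (a : ℝ) (z : ℝ × ℝ) => (z.1 - min 0 a, z.2)) (by fun_prop) (.of_forall fun a => ?_)
    exact ((measurePreserving_sub_right volume _).prod (MeasurePreserving.id volume)).map_eq
  have h4 : MeasurePreserving (fun z : ℝ × ℝ × ℝ => (z.1, (z.2.1 + z.1, z.2.2)))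
      volume volume := by
    refine (MeasurePreserving.id (volume : Measure ℝ)).skew_product
      (g := fun (a : ℝ) (z : ℝ × ℝ) => (z.1 + a, z.2)) (by fun_prop) (.of_forall fun a => ?_)
    exact ((measurePreserving_add_right volume a).prod (MeasurePreserving.id volume)).map_eq
  have swap : MeasurePreserving (Prod.swap : ℝ × ℝ × ℝ → (ℝ × ℝ) × ℝ) volume volume :=
    Measure.measurePreserving_swap
  have assoc : MeasurePreserving (fun z : (ℝ × ℝ) × ℝ => (z.1.1, (z.1.2, z.2)))
      volume volume := volume_preserving_prodAssoc
  have assoc' : MeasurePreserving (fun z : ℝ × ℝ × ℝ => ((z.1, z.2.1), z.2.2))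
      volume volume := volume_preserving_prodAssoc.symm
  have flip : MeasurePreserving (fun z : (ℝ × ℝ) × ℝ => ((z.1.2, z.1.1), z.2))
      volume volume :=
    (Measure.measurePreserving_swap (μ := (volume : Measure ℝ))
      (ν := (volume : Measure ℝ))).prod (MeasurePreserving.id (volume : Measure ℝ))
  convert! h4.comp (assoc.comp (flip.comp (assoc'.comp (h3.comp (assoc.comp
    (h2.comp (swap.comp h1)))))))
  ext z
  · simp only [corner, Function.comp, Prod.swap]
    rcases le_total z.1 z.2.1 with h | h
    · rw [max_eq_right (by linarith), min_eq_left (by linarith)]; ring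
    · rw [max_eq_left (by linarith), min_eq_right (by linarith)]; ring
  · simp only [corner, Function.comp, Prod.swap]
    rcases le_total z.1 z.2.1 with h | h
    · rw [max_eq_left (by linarith), min_eq_left (by linarith)]; ring
    · rw [max_eq_right (by linarith), min_eq_right (by linarith)]; ring
  · simp only [corner, Function.comp, Prod.swap]
    rcases le_total z.1 z.2.1 with h | h
    · rw [min_eq_left h, min_eq_left (by linarith)]; ring
    · rw [min_eq_right h, min_eq_right (by linarith)]; ring

/-- Burke's property of a single square: the corner map preserves
`Exp(p) ⊗ Exp(q) ⊗ Exp(1)` when `p + q = 1`, since it preserves Lebesgue measure and leaves the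
density unchanged. -/
lemma measurePreserving_corner {p q : ℝ} (hp : 0 < p) (hq : 0 < q) (hpq : p + q = 1) :
    MeasurePreserving corner
      ((expMeasure p).prod ((expMeasure q).prod (expMeasure 1)))
      ((expMeasure p).prod ((expMeasure q).prod (expMeasure 1))) := by
  set f : ℝ × ℝ × ℝ → ℝ≥0∞ := fun z =>
    exponentialPDF p z.1 * (exponentialPDF q z.2.1 * exponentialPDF 1 z.2.2) with hf
  have hmeas : ∀ r, Measurable (exponentialPDF r) := measurable_exponentialPDF
  have hfm : Measurable f := by
    refine ((hmeas p).comp measurable_fst).mul (((hmeas q).comp ?_).mul ((hmeas 1).comp ?_)) <;>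
    fun_prop
  have hμ : (expMeasure p).prod ((expMeasure q).prod (expMeasure 1)) = volume.withDensity f := by
    have := isProbabilityMeasure_expMeasure hq
    have := isProbabilityMeasure_expMeasure one_pos
    have h1 : (expMeasure q).prod (expMeasure 1) = (volume.prod volume).withDensity
        (fun z : ℝ × ℝ => exponentialPDF q z.1 * exponentialPDF 1 z.2) :=
      prod_withDensity (hmeas q) (hmeas 1)
    have h2 : Measurable fun z : ℝ × ℝ => exponentialPDF q z.1 * exponentialPDF 1 z.2 :=
      ((hmeas q).comp measurable_fst).mul ((hmeas 1).comp measurable_snd)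
    rw [h1, expMeasure_eq_withDensity, prod_withDensity (hmeas p) h2]
    rfl
  have hinv : ∀ z, f (corner z) = f z := by
    rintro ⟨I, J, w⟩
    have key : ∀ a b c : ℝ, f (a, b, c) = if 0 ≤ a ∧ 0 ≤ b ∧ 0 ≤ c then
        ENNReal.ofReal (p * q * Real.exp (-(p * a + q * b + c))) else 0 := by
      intro a b c
      simp only [hf, exponentialPDF_eq]
      split_ifs with h1 h2 h3 h4 h5 h6 h7 <;> try tauto
      · rw [← ENNReal.ofReal_mul (by positivity), ← ENNReal.ofReal_mul (by positivity)]
        congr 1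
        rw [show -(p * a + q * b + c) = -(p * a) + (-(q * b) + -(1 * c)) by ring, Real.exp_add,
          Real.exp_add]
        ring
      all_goals simp
    simp only [corner]
    rw [key, key]
    have hq' : q = 1 - p := by linarith
    subst hq'
    rcases le_total I J with h | h
    · rw [max_eq_right (by linarith), max_eq_left (by linarith), min_eq_left h]
      refine if_congr ?_ ?_ rfl
      · constructor
        · rintro ⟨h1, h2, h3⟩; refine ⟨?_, ?_, ?_⟩ <;> linarith
        · rintro ⟨h1, h2, h3⟩; refine ⟨?_, ?_, ?_⟩ <;> linarith
      · congr 3; ring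
    · rw [max_eq_left (by linarith), max_eq_right (by linarith), min_eq_right h]
      refine if_congr ?_ ?_ rfl
      · constructor
        · rintro ⟨h1, h2, h3⟩; refine ⟨?_, ?_, ?_⟩ <;> linarith
        · rintro ⟨h1, h2, h3⟩; refine ⟨?_, ?_, ?_⟩ <;> linarith
      · congr 3; ring
  rw [hμ]
  refine ⟨measurable_corner, ?_⟩
  ext s hs
  rw [Measure.map_apply measurable_corner hs, withDensity_apply _ hs,
    withDensity_apply _ (measurable_corner hs),
    ← measurePreserving_corner_volume.setLIntegral_comp_preimage hs hfm]
  simp only [hinv]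

/-! ### Chernoff bounds for exponential variables -/

lemma mgf_expMeasure {r t : ℝ} (hr : 0 < r) (htr : t < r) :
    Integrable (fun x => Real.exp (t * x)) (expMeasure r) ∧
      mgf id (expMeasure r) t = r / (r - t) := by
  have hpos : 0 < r - t := by linarith
  have hl : ∫⁻ x, ENNReal.ofReal (Real.exp (t * x)) ∂(expMeasure r)
      = ENNReal.ofReal (r / (r - t)) := by
    rw [expMeasure_eq_withDensity,
      lintegral_withDensity_eq_lintegral_mul _ (measurable_exponentialPDF r) (by fun_prop)]
    have : ∀ x, (exponentialPDF r * fun x => ENNReal.ofReal (Real.exp (t * x))) x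
        = ENNReal.ofReal (r / (r - t)) * exponentialPDF (r - t) x := by
      intro x
      simp only [Pi.mul_apply, exponentialPDF_eq]
      split_ifs with h
      · rw [← ENNReal.ofReal_mul (by positivity), ← ENNReal.ofReal_mul (by positivity)]
        congr 1
        rw [show -((r - t) * x) = -(r * x) + t * x by ring, Real.exp_add]
        field_simp
      · simp
    simp only [this]
    rw [lintegral_const_mul _ (measurable_exponentialPDF _), lintegral_exponentialPDF_eq_one hpos,
      mul_one]
  constructor
  · refine ⟨by fun_prop, ?_⟩
    rw [hasFiniteIntegral_iff_ofReal (.of_forall fun x => (Real.exp_pos _).le), hl]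
    exact ENNReal.ofReal_lt_top
  · rw [mgf, integral_eq_lintegral_of_nonneg_ae (.of_forall fun x => (Real.exp_pos _).le)
      (by simp only [id]; fun_prop)]
    simp only [id, hl]
    exact ENNReal.toReal_ofReal (by positivity)

lemma inv_one_sub_le_exp {s : ℝ} (hs : s ≤ 1 / 2) :
    (1 - s)⁻¹ ≤ Real.exp (s + 2 * s ^ 2) := by
  have h0 : 0 < 1 - s := by linarith
  have h1 : (1 - s)⁻¹ ≤ 1 + (s + 2 * s ^ 2) := by
    rw [inv_le_iff_one_le_mul₀ h0]
    nlinarith [mul_nonneg (sq_nonneg s) (by linarith : (0 : ℝ) ≤ 1 - 2 * s)]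
  have h2 := Real.add_one_le_exp (s + 2 * s ^ 2)
  linarith

/-- The exponential moment bound behind both tails; the tilt `s * r` is measured in units of the
rate `r`, and `s` may be negative. -/
lemma mgf_sum_le {r s : ℝ} (hr : 0 < r) (hs : s ≤ 1 / 2) (m : ℕ) :
    Integrable (fun a : ℕ → ℝ => Real.exp (s * r * ∑ i ∈ Finset.range m, a i))
      (Measure.infinitePi fun _ : ℕ => expMeasure r) ∧
    mgf (fun a : ℕ → ℝ => ∑ i ∈ Finset.range m, a i)
      (Measure.infinitePi fun _ : ℕ => expMeasure r) (s * r)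
      ≤ Real.exp (m * (s + 2 * s ^ 2)) := by
  have := isProbabilityMeasure_expMeasure hr
  have hlt : s * r < r := by nlinarith
  have hind : iIndepFun (fun (i : ℕ) (a : ℕ → ℝ) => a i)
      (Measure.infinitePi fun _ : ℕ => expMeasure r) :=
    iIndepFun_infinitePi (X := fun _ x => x) (fun _ => measurable_id)
  have hev : ∀ i : ℕ, MeasurePreserving (fun a : ℕ → ℝ => a i)
      (Measure.infinitePi fun _ : ℕ => expMeasure r) (expMeasure r) :=
    fun i => measurePreserving_eval_infinitePi _ i
  have hint : ∀ i : ℕ, Integrable (fun a : ℕ → ℝ => Real.exp (s * r * a i))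
      (Measure.infinitePi fun _ : ℕ => expMeasure r) := fun i =>
    (hev i).integrable_comp_of_integrable (mgf_expMeasure hr hlt).1
  have hmgf : ∀ i : ℕ, mgf (fun a : ℕ → ℝ => a i)
      (Measure.infinitePi fun _ : ℕ => expMeasure r) (s * r) = (1 - s)⁻¹ := by
    intro i
    have := (mgf_expMeasure hr hlt).2
    rw [← (hev i).map_eq, mgf_map (hev i).measurable.aemeasurable (by fun_prop)] at this
    rw [show (fun a : ℕ → ℝ => a i) = id ∘ fun a : ℕ → ℝ => a i from rfl, this]
    have : 1 - s ≠ 0 := by linarith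
    have : r - s * r ≠ 0 := by linarith
    field_simp
  have hsum : (fun a : ℕ → ℝ => ∑ i ∈ Finset.range m, a i)
      = ∑ i ∈ Finset.range m, fun a : ℕ → ℝ => a i := by
    ext a; simp
  constructor
  · have := hind.integrable_exp_mul_sum (t := s * r) (fun i => measurable_pi_apply i)
      (s := Finset.range m) (fun i _ => hint i)
    simpa using this
  · rw [hsum, hind.mgf_sum (fun i => measurable_pi_apply i)]
    simp only [hmgf, Finset.prod_const, Finset.card_range]
    rw [mul_comm (m : ℝ), Real.exp_mul, Real.rpow_natCast]
    have : 0 < 1 - s := by linarith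
    gcongr
    exact inv_one_sub_le_exp hs

/-- Exponential concentration of sums of i.i.d. `Exp(r)` variables around their mean, uniformly in
the number `m ≤ N` of summands. -/
lemma exists_exp_sum_tail {r δ : ℝ} (hr : 0 < r) (hδ : 0 < δ) :
    ∃ κ > 0, ∀ N m : ℕ, m ≤ N →
      (Measure.infinitePi fun _ : ℕ => expMeasure r)
        {a | m / r + δ * N ≤ ∑ i ∈ Finset.range m, a i} ≤ ENNReal.ofReal (Real.exp (-κ * N)) ∧
      (Measure.infinitePi fun _ : ℕ => expMeasure r)
        {a | ∑ i ∈ Finset.range m, a i ≤ m / r - δ * N} ≤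
          ENNReal.ofReal (Real.exp (-κ * N)) := by
  have := isProbabilityMeasure_expMeasure hr
  -- the tilt `s` is so small that the quadratic error `2 s²` is at most half the gain `s r δ`
  obtain ⟨s, hs0, hs1, hs2⟩ : ∃ s : ℝ, 0 < s ∧ s ≤ 1 / 2 ∧ s ≤ r * δ / 4 :=
    ⟨min (1 / 2) (r * δ / 4), by positivity, min_le_left _ _, min_le_right _ _⟩
  refine ⟨s * r * δ / 2, by positivity, fun N m hm => ?_⟩
  have hmN : (m : ℝ) ≤ N := by exact_mod_cast hm
  have hN : (0 : ℝ) ≤ N := Nat.cast_nonneg N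
  have hq : (m : ℝ) * (2 * s ^ 2) ≤ s * r * δ / 2 * N := by
    calc (m : ℝ) * (2 * s ^ 2) ≤ N * (2 * s ^ 2) := by gcongr
      _ = N * (2 * s * s) := by ring
      _ ≤ N * (2 * s * (r * δ / 4)) := by gcongr
      _ = _ := by ring
  constructor
  · rw [← ofReal_measureReal]
    apply ENNReal.ofReal_le_ofReal
    refine (measure_ge_le_exp_mul_mgf _ (t := s * r) (by positivity)
      (mgf_sum_le hr hs1 m).1).trans ?_
    refine (mul_le_mul_of_nonneg_left (mgf_sum_le hr hs1 m).2 (Real.exp_pos _).le).trans ?_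
    rw [← Real.exp_add]
    apply Real.exp_le_exp.mpr
    have : -(s * r) * (m / r + δ * N) = -(s * m) - s * r * δ * N := by field_simp; ring
    rw [this]
    linarith
  · rw [← ofReal_measureReal]
    apply ENNReal.ofReal_le_ofReal
    have hs' : -s ≤ 1 / 2 := by linarith
    refine (measure_le_le_exp_mul_mgf _ (t := -s * r) (by nlinarith)
      (mgf_sum_le hr hs' m).1).trans ?_
    refine (mul_le_mul_of_nonneg_left (mgf_sum_le hr hs' m).2 (Real.exp_pos _).le).trans ?_
    rw [← Real.exp_add]
    apply Real.exp_le_exp.mpr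
    have : -(-s * r) * (m / r - δ * N) = s * m - s * r * δ * N := by field_simp
    rw [this]
    have : (-s) ^ 2 = s ^ 2 := by ring
    rw [this]
    linarith

/-! ### Stationary transducers -/

section Transducer

variable {S A B : Type*}

/-- The state after `n` steps of a transducer with transition map `F`, which turns a state and an
input letter into a new state and an output letter, started at `s` and fed with the inputs `a`. -/
def runState (F : S × A → S × B) (s : S) (a : ℕ → A) : ℕ → S
  | 0 => s
  | n + 1 => (F (runState F s a n, a n)).1

/-- The output letter of step `n` of a transducer. -/
def runOut (F : S × A → S × B) (s : S) (a : ℕ → A) (n : ℕ) : B :=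
  (F (runState F s a n, a n)).2

lemma runState_succ_eq (F : S × A → S × B) (s : S) (a : ℕ → A) (n : ℕ) :
    runState F s a (n + 1) = runState F (F (s, a 0)).1 (fun k => a (k + 1)) n := by
  induction n with
  | zero => rfl
  | succ n ih => rw [runState, ih]; rfl

lemma runOut_succ_eq (F : S × A → S × B) (s : S) (a : ℕ → A) (n : ℕ) :
    runOut F s a (n + 1) = runOut F (F (s, a 0)).1 (fun k => a (k + 1)) n := by
  rw [runOut, runState_succ_eq]; rfl

variable [MeasurableSpace S] [MeasurableSpace A] [MeasurableSpace B]

lemma eq_infinitePi_of_initial_boxes (α : Measure A) [IsProbabilityMeasure α]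
    (ν : Measure (ℕ → A))
    (h : ∀ (n : ℕ) (t : ℕ → Set A), (∀ i, MeasurableSet (t i)) →
      ν {a | ∀ i < n, a i ∈ t i} = ∏ i ∈ Finset.range n, α (t i)) :
    ν = Measure.infinitePi fun _ => α := by
  classical
  refine Measure.eq_infinitePi _ fun s t ht => ?_
  set t' : ℕ → Set A := fun i => if i ∈ s then t i else Set.univ with ht'
  obtain ⟨n, hn⟩ : ∃ n, s ⊆ Finset.range n := s.exists_nat_subset_range
  have hset : (s : Set ℕ).pi t = {a | ∀ i < n, a i ∈ t' i} := by
    ext a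
    simp only [Set.mem_pi, Finset.mem_coe, Set.mem_ofPred_eq, ht']
    constructor
    · intro h i _
      split_ifs with his
      · exact h i his
      · trivial
    · intro h i his
      simpa [his] using h i (Finset.mem_range.mp (hn his))
  rw [hset, h n t' (fun i => by simp only [ht']; split_ifs; exacts [ht i, .univ]),
    ← Finset.prod_subset hn]
  · exact Finset.prod_congr rfl fun i hi => by simp [ht', hi]
  · intro i _ his
    simp [ht', his]

lemma measurePreserving_uncons (α : Measure A) [IsProbabilityMeasure α] :
    MeasurePreserving (fun a : ℕ → A => (a 0, fun k => a (k + 1)))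
      (Measure.infinitePi fun _ : ℕ => α) (α.prod (Measure.infinitePi fun _ : ℕ => α)) := by
  set cons : A × (ℕ → A) → ℕ → A := fun z n => Nat.casesOn n z.1 z.2 with hcons
  have hcm : Measurable cons := by
    refine measurable_pi_iff.mpr fun n => ?_
    cases n with
    | zero => exact measurable_fst
    | succ k => exact (measurable_pi_apply k).comp measurable_snd
  have hum : Measurable (fun a : ℕ → A => (a 0, fun k => a (k + 1))) := by fun_prop
  have hmap : (α.prod (Measure.infinitePi fun _ : ℕ => α)).map cons
      = Measure.infinitePi fun _ => α := by
    refine eq_infinitePi_of_initial_boxes α _ fun n t ht => ?_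
    have hms : MeasurableSet {a : ℕ → A | ∀ i < n, a i ∈ t i} := by
      have : {a : ℕ → A | ∀ i < n, a i ∈ t i} = (Finset.range n : Set ℕ).pi t := by
        ext; simp
      rw [this]
      exact .pi (Finset.countable_toSet _) fun i _ => ht i
    rw [Measure.map_apply hcm hms]
    cases n with
    | zero => simp
    | succ n =>
      have : cons ⁻¹' {a | ∀ i < n + 1, a i ∈ t i}
          = t 0 ×ˢ ((Finset.range n : Set ℕ).pi fun i => t (i + 1)) := by
        ext z
        simp only [Set.mem_preimage, Set.mem_ofPred_eq, Set.mem_prod, Set.mem_pi, Finset.coe_range,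
          Set.mem_Iio]
        constructor
        · intro h
          exact ⟨h 0 (by omega), fun i hi => h (i + 1) (by omega)⟩
        · rintro ⟨h0, h⟩ i hi
          cases i with
          | zero => exact h0
          | succ i => exact h i (by omega)
      rw [this, Measure.prod_prod, Measure.infinitePi_pi _ (fun i _ => ht (i + 1)),
        Finset.prod_range_succ', mul_comm]
  refine ⟨hum, ?_⟩
  conv_lhs => rw [← hmap, Measure.map_map hum hcm]
  exact Measure.map_id

variable {F : S × A → S × B}

lemma measurable_runState (hF : Measurable F) (n : ℕ) :
    Measurable fun z : S × (ℕ → A) => runState F z.1 z.2 n := by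
  induction n with
  | zero => exact measurable_fst
  | succ n ih =>
    exact (hF.comp (ih.prodMk ((measurable_pi_apply n).comp measurable_snd))).fst

lemma measurable_runOut (hF : Measurable F) (n : ℕ) :
    Measurable fun z : S × (ℕ → A) => runOut F z.1 z.2 n :=
  (hF.comp ((measurable_runState hF n).prodMk ((measurable_pi_apply n).comp measurable_snd))).snd

/-- One step of a stationary transducer: the output letter is independent of the new state and the
remaining inputs, which are again in the stationary law. -/
lemma measurePreserving_transducer_step {μ : Measure S} {α : Measure A} {β : Measure B}
    [IsProbabilityMeasure μ] [IsProbabilityMeasure α] [IsProbabilityMeasure β]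
    (hF : MeasurePreserving F (μ.prod α) (μ.prod β)) :
    MeasurePreserving
      (fun z : S × (ℕ → A) => ((F (z.1, z.2 0)).2, ((F (z.1, z.2 0)).1, fun k => z.2 (k + 1))))
      (μ.prod (Measure.infinitePi fun _ : ℕ => α))
      (β.prod (μ.prod (Measure.infinitePi fun _ : ℕ => α))) := by
  have h1 := (MeasurePreserving.id μ).prod (measurePreserving_uncons α)
  have h2 := (measurePreserving_prodAssoc μ α (Measure.infinitePi fun _ : ℕ => α)).symm
  have h3 := hF.prod (MeasurePreserving.id (Measure.infinitePi fun _ : ℕ => α))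
  have h4 := (Measure.measurePreserving_swap (μ := μ) (ν := β)).prod
    (MeasurePreserving.id (Measure.infinitePi fun _ : ℕ => α))
  have h5 := measurePreserving_prodAssoc β μ (Measure.infinitePi fun _ : ℕ => α)
  exact h5.comp (h4.comp (h3.comp (h2.comp h1)))

lemma measurePreserving_runState {μ : Measure S} {α : Measure A} {β : Measure B}
    [IsProbabilityMeasure μ] [IsProbabilityMeasure α] [IsProbabilityMeasure β]
    (hF : MeasurePreserving F (μ.prod α) (μ.prod β)) (n : ℕ) :
    MeasurePreserving (fun z : S × (ℕ → A) => runState F z.1 z.2 n)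
      (μ.prod (Measure.infinitePi fun _ : ℕ => α)) μ := by
  induction n with
  | zero => exact measurePreserving_fst
  | succ n ih =>
    have := ih.comp (measurePreserving_snd.comp (measurePreserving_transducer_step hF))
    convert! this using 2 with z
    exact runState_succ_eq F z.1 z.2 n

/-- The outputs of a stationary transducer fed with i.i.d. inputs are i.i.d. -/
lemma measurePreserving_runOut {μ : Measure S} {α : Measure A} {β : Measure B}
    [IsProbabilityMeasure μ] [IsProbabilityMeasure α] [IsProbabilityMeasure β]
    (hF : MeasurePreserving F (μ.prod α) (μ.prod β)) :
    MeasurePreserving (fun z : S × (ℕ → A) => runOut F z.1 z.2)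
      (μ.prod (Measure.infinitePi fun _ : ℕ => α)) (Measure.infinitePi fun _ : ℕ => β) := by
  have hm : Measurable fun z : S × (ℕ → A) => runOut F z.1 z.2 :=
    measurable_pi_iff.mpr fun n => measurable_runOut hF.measurable n
  have hms : ∀ (n : ℕ) (t : ℕ → Set B), (∀ i, MeasurableSet (t i)) →
      MeasurableSet {a : ℕ → B | ∀ i < n, a i ∈ t i} := by
    intro n t ht
    have : {a : ℕ → B | ∀ i < n, a i ∈ t i} = (Finset.range n : Set ℕ).pi t := by
      ext; simp
    rw [this]
    exact .pi (Finset.countable_toSet _) fun i _ => ht i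
  refine ⟨hm, eq_infinitePi_of_initial_boxes β _ fun n => ?_⟩
  induction n with
  | zero =>
    intro t ht
    rw [Measure.map_apply hm (hms 0 t ht)]
    simp
  | succ n ih =>
    intro t ht
    specialize ih (fun i => t (i + 1)) (fun i => ht (i + 1))
    rw [Measure.map_apply hm (hms n _ fun i => ht (i + 1))] at ih
    rw [Measure.map_apply hm (hms _ t ht), Finset.prod_range_succ', ← ih, mul_comm,
      ← Measure.prod_prod, ← (measurePreserving_transducer_step hF).measure_preimage
        ((ht 0).prod (hm (hms n _ fun i => ht (i + 1)))).nullMeasurableSet]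
    congr 1
    ext z
    simp only [Set.mem_preimage, Set.mem_ofPred_eq, Set.mem_prod]
    constructor
    · intro h
      refine ⟨h 0 (by omega), fun i hi => ?_⟩
      rw [← runOut_succ_eq]
      exact h (i + 1) (by omega)
    · rintro ⟨h0, h⟩ i hi
      cases i with
      | zero => exact h0
      | succ i =>
        rw [runOut_succ_eq]
        exact h i (by omega)

end Transducer

section Zip

variable {A B : Type*} [MeasurableSpace A] [MeasurableSpace B]

/-- Zipping two independent i.i.d. sequences is the output of the transducer without inputs that
reads off the two sequences letter by letter. -/
lemma measurePreserving_zip (α : Measure A) (β : Measure B) [IsProbabilityMeasure α]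
    [IsProbabilityMeasure β] :
    MeasurePreserving (fun z : (ℕ → A) × (ℕ → B) => fun k => (z.1 k, z.2 k))
      ((Measure.infinitePi fun _ : ℕ => α).prod (Measure.infinitePi fun _ : ℕ => β))
      (Measure.infinitePi fun _ : ℕ => α.prod β) := by
  set μ := (Measure.infinitePi fun _ : ℕ => α).prod (Measure.infinitePi fun _ : ℕ => β) with hμ
  set F : ((ℕ → A) × (ℕ → B)) × Unit → ((ℕ → A) × (ℕ → B)) × (A × B) := fun s =>
    ((fun k => s.1.1 (k + 1), fun k => s.1.2 (k + 1)), (s.1.1 0, s.1.2 0)) with hFdef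
  have hFm : Measurable F := by fun_prop
  have hF : MeasurePreserving F (μ.prod (Measure.dirac ())) (μ.prod (α.prod β)) := by
    have h1 : MeasurePreserving Prod.fst (μ.prod (Measure.dirac ())) μ := measurePreserving_fst
    have h2 := (measurePreserving_uncons α).prod (measurePreserving_uncons β)
    have h3 := measurePreserving_prodAssoc α (Measure.infinitePi fun _ : ℕ => α)
      (β.prod (Measure.infinitePi fun _ : ℕ => β))
    have h4 := (measurePreserving_prodAssoc (Measure.infinitePi fun _ : ℕ => α) β
      (Measure.infinitePi fun _ : ℕ => β)).symm
    have h5 := (Measure.measurePreserving_swap (μ := Measure.infinitePi fun _ : ℕ => α)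
      (ν := β)).prod (MeasurePreserving.id (Measure.infinitePi fun _ : ℕ => β))
    have h6 := measurePreserving_prodAssoc β (Measure.infinitePi fun _ : ℕ => α)
      (Measure.infinitePi fun _ : ℕ => β)
    have h7 := (MeasurePreserving.id α).prod (h6.comp (h5.comp h4))
    have h8 := (measurePreserving_prodAssoc α β μ).symm
    have h9 := Measure.measurePreserving_swap (μ := α.prod β) (ν := μ)
    exact h9.comp (h8.comp (h7.comp (h3.comp (h2.comp h1))))
  have hstate : ∀ (s : (ℕ → A) × (ℕ → B)) (a : ℕ → Unit) (n : ℕ),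
      runState F s a n = (fun k => s.1 (k + n), fun k => s.2 (k + n)) := by
    intro s a n
    induction n with
    | zero => rfl
    | succ n ih =>
      rw [runState, ih]
      ext k <;> simp [hFdef, add_assoc, add_comm 1 n]
  have hout := measurePreserving_runOut hF
  have heq : (fun z : ((ℕ → A) × (ℕ → B)) × (ℕ → Unit) => runOut F z.1 z.2)
      = (fun z : (ℕ → A) × (ℕ → B) => fun k => (z.1 k, z.2 k)) ∘ Prod.fst := by
    ext z k : 2
    simp only [runOut, hstate]
    simp [hFdef]
  refine ⟨by fun_prop, ?_⟩
  have hfst : MeasurePreserving Prod.fst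
      (μ.prod (Measure.infinitePi fun _ : ℕ => Measure.dirac ())) μ := measurePreserving_fst
  rw [← hout.map_eq, heq, ← Measure.map_map (by fun_prop) measurable_fst, hfst.map_eq]

lemma measurePreserving_unzip (α : Measure A) (β : Measure B) [IsProbabilityMeasure α]
    [IsProbabilityMeasure β] :
    MeasurePreserving (fun z : ℕ → A × B => (fun k => (z k).1, fun k => (z k).2))
      (Measure.infinitePi fun _ : ℕ => α.prod β)
      ((Measure.infinitePi fun _ : ℕ => α).prod (Measure.infinitePi fun _ : ℕ => β)) := by
  refine ⟨by fun_prop, ?_⟩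
  rw [← (measurePreserving_zip α β).map_eq, Measure.map_map (by fun_prop) (by fun_prop)]
  exact Measure.map_id

end Zip

/-! ### Stationary last-passage percolation on the quadrant -/

/-- The random input of last-passage percolation on the quadrant: the vertical increments on the
left boundary, and for every column of unit squares the horizontal increment on its bottom edge
together with the weights of the north-east vertices of its squares. -/
abbrev Noise : Type := (ℕ → ℝ) × (ℕ → ℝ × (ℕ → ℝ))

/-- The law of the input of the stationary model: horizontal boundary increments `Exp(p)`, vertical
boundary increments `Exp(q)` and bulk weights `Exp(1)`, all independent. -/
noncomputable def stationaryNoise (p q : ℝ) : Measure Noise :=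
  (Measure.infinitePi fun _ : ℕ => expMeasure q).prod
    (Measure.infinitePi fun _ : ℕ =>
      (expMeasure p).prod (Measure.infinitePi fun _ : ℕ => expMeasure 1))

/-- One column of unit squares, from bottom to top: the vertical increments on its left side, the
increment on its bottom edge and its bulk weights determine the vertical increments on its right
side and its dual weights. -/
def columnStep (z : (ℕ → ℝ) × ℝ × (ℕ → ℝ)) : (ℕ → ℝ) × (ℕ → ℝ) :=
  (fun k => (runOut corner z.2.1 (fun k => (z.1 k, z.2.2 k)) k).1,
    fun k => (runOut corner z.2.1 (fun k => (z.1 k, z.2.2 k)) k).2)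

/-- The last-passage increment along the vertical edge from `(m, k)` to `(m, k + 1)`. -/
def upIncrement (z : Noise) (m k : ℕ) : ℝ := runState columnStep z.1 z.2 m k

/-- The last-passage increment along the horizontal edge from `(m, k)` to `(m + 1, k)`. -/
def rightIncrement (z : Noise) (m k : ℕ) : ℝ :=
  runState corner (z.2 m).1 (fun k => (upIncrement z m k, (z.2 m).2 k)) k

/-- The dual weight of the vertex `(m, k)`, the smaller of the two increments leaving it. -/
def dualWeight (z : Noise) (m k : ℕ) : ℝ := runOut columnStep z.1 z.2 m k

/-- The last-passage time of `(m, k)`, summed along the bottom and then along column `m`. -/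
def height (z : Noise) (m k : ℕ) : ℝ :=
  ∑ i ∈ Finset.range m, (z.2 i).1 + ∑ l ∈ Finset.range k, upIncrement z m l

lemma dualWeight_eq_min (z : Noise) (m k : ℕ) :
    dualWeight z m k = min (rightIncrement z m k) (upIncrement z m k) := rfl

lemma upIncrement_succ (z : Noise) (m k : ℕ) :
    upIncrement z (m + 1) k =
      (z.2 m).2 k + max (upIncrement z m k - rightIncrement z m k) 0 := rfl

lemma rightIncrement_succ (z : Noise) (m k : ℕ) :
    rightIncrement z m (k + 1) =
      (z.2 m).2 k + max (rightIncrement z m k - upIncrement z m k) 0 := rfl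

lemma height_succ_up (z : Noise) (m k : ℕ) :
    height z m (k + 1) = height z m k + upIncrement z m k := by
  rw [height, height, Finset.sum_range_succ]; ring

lemma height_succ_right (z : Noise) (m k : ℕ) :
    height z (m + 1) k = height z m k + rightIncrement z m k := by
  induction k with
  | zero => simp [height, Finset.sum_range_succ, rightIncrement, runState]
  | succ k ih =>
    rw [height_succ_up, height_succ_up, ih, upIncrement_succ, rightIncrement_succ]
    rcases le_total (upIncrement z m k) (rightIncrement z m k) with h | h
    · rw [max_eq_right (sub_nonpos.mpr h), max_eq_left (sub_nonneg.mpr h)]; ring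
    · rw [max_eq_left (sub_nonneg.mpr h), max_eq_right (sub_nonpos.mpr h)]; ring

lemma measurable_columnStep : Measurable columnStep := by
  have h : ∀ k, Measurable fun z : (ℕ → ℝ) × ℝ × (ℕ → ℝ) =>
      runOut corner z.2.1 (fun k => (z.1 k, z.2.2 k)) k := fun k =>
    (measurable_runOut measurable_corner k).comp
      (by fun_prop : Measurable fun z : (ℕ → ℝ) × ℝ × (ℕ → ℝ) =>
        (z.2.1, fun k => (z.1 k, z.2.2 k)))
  exact (measurable_pi_iff.mpr fun k => (h k).fst).prodMk
    (measurable_pi_iff.mpr fun k => (h k).snd)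

lemma measurable_upIncrement (m k : ℕ) : Measurable fun z => upIncrement z m k :=
  (measurable_pi_apply k).comp (measurable_runState measurable_columnStep m)

lemma measurable_rightIncrement (m k : ℕ) : Measurable fun z => rightIncrement z m k := by
  have h : Measurable fun z : Noise =>
      ((z.2 m).1, fun k => (upIncrement z m k, (z.2 m).2 k)) := by
    refine Measurable.prodMk (by fun_prop) (measurable_pi_iff.mpr fun k => ?_)
    exact (measurable_upIncrement m k).prodMk (by fun_prop)
  exact (measurable_runState measurable_corner k).comp h

lemma isProbabilityMeasure_stationaryNoise {p q : ℝ} (hp : 0 < p) (hq : 0 < q) :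
    IsProbabilityMeasure (stationaryNoise p q) := by
  have := isProbabilityMeasure_expMeasure hp
  have := isProbabilityMeasure_expMeasure hq
  have := isProbabilityMeasure_expMeasure one_pos
  unfold stationaryNoise
  infer_instance

lemma measurePreserving_bottom {p q : ℝ} (hp : 0 < p) (hq : 0 < q) :
    MeasurePreserving (fun (z : Noise) i => (z.2 i).1) (stationaryNoise p q)
      (Measure.infinitePi fun _ : ℕ => expMeasure p) := by
  have := isProbabilityMeasure_expMeasure hp
  have := isProbabilityMeasure_expMeasure hq
  have := isProbabilityMeasure_expMeasure one_pos
  exact measurePreserving_fst.comp ((measurePreserving_unzip (expMeasure p)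
    (Measure.infinitePi fun _ : ℕ => expMeasure 1)).comp measurePreserving_snd)

lemma measurePreserving_columnStep {p q : ℝ} (hp : 0 < p) (hq : 0 < q)
    (hpq : p + q = 1) :
    MeasurePreserving columnStep
      ((Measure.infinitePi fun _ : ℕ => expMeasure q).prod
        ((expMeasure p).prod (Measure.infinitePi fun _ : ℕ => expMeasure 1)))
      ((Measure.infinitePi fun _ : ℕ => expMeasure q).prod
        (Measure.infinitePi fun _ : ℕ => expMeasure 1)) := by
  have := isProbabilityMeasure_expMeasure hp
  have := isProbabilityMeasure_expMeasure hq
  have := isProbabilityMeasure_expMeasure one_pos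
  have h1 := (measurePreserving_prodAssoc (Measure.infinitePi fun _ : ℕ => expMeasure q)
    (expMeasure p) (Measure.infinitePi fun _ : ℕ => expMeasure 1)).symm
  have h2 := (Measure.measurePreserving_swap (μ := Measure.infinitePi fun _ : ℕ => expMeasure q)
    (ν := expMeasure p)).prod
      (MeasurePreserving.id (Measure.infinitePi fun _ : ℕ => expMeasure 1))
  have h3 := measurePreserving_prodAssoc (expMeasure p)
    (Measure.infinitePi fun _ : ℕ => expMeasure q) (Measure.infinitePi fun _ : ℕ => expMeasure 1)
  have h4 := (MeasurePreserving.id (expMeasure p)).prod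
    (measurePreserving_zip (expMeasure q) (expMeasure 1))
  have h5 := measurePreserving_runOut (measurePreserving_corner hp hq hpq)
  have h6 := measurePreserving_unzip (expMeasure q) (expMeasure 1)
  exact h6.comp (h5.comp (h4.comp (h3.comp (h2.comp h1))))

lemma measurePreserving_upIncrement {p q : ℝ} (hp : 0 < p) (hq : 0 < q)
    (hpq : p + q = 1) (m : ℕ) :
    MeasurePreserving (fun z => upIncrement z m) (stationaryNoise p q)
      (Measure.infinitePi fun _ : ℕ => expMeasure q) := by
  have := isProbabilityMeasure_expMeasure hp
  have := isProbabilityMeasure_expMeasure hq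
  have := isProbabilityMeasure_expMeasure one_pos
  exact measurePreserving_runState (measurePreserving_columnStep hp hq hpq) m

/-- Burke's property of the quadrant: the dual weights are again i.i.d. `Exp(1)`. -/
lemma measurePreserving_dualWeight {p q : ℝ} (hp : 0 < p) (hq : 0 < q)
    (hpq : p + q = 1) :
    MeasurePreserving dualWeight (stationaryNoise p q)
      (Measure.infinitePi fun _ : ℕ => Measure.infinitePi fun _ : ℕ => expMeasure 1) := by
  have := isProbabilityMeasure_expMeasure hp
  have := isProbabilityMeasure_expMeasure hq
  have := isProbabilityMeasure_expMeasure one_pos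
  exact measurePreserving_runOut (measurePreserving_columnStep hp hq hpq)

/-- Rescaling of unit-rate boundary increments to the rates `p` and `q`. -/
noncomputable def rescale (p q : ℝ) (z : Noise) : Noise :=
  (fun k => z.1 k / q, fun m => ((z.2 m).1 / p, (z.2 m).2))

lemma measurePreserving_rescale {p q : ℝ} (hp : 0 < p) (hq : 0 < q) :
    MeasurePreserving (rescale p q) (stationaryNoise 1 1) (stationaryNoise p q) := by
  have := isProbabilityMeasure_expMeasure hp
  have := isProbabilityMeasure_expMeasure hq
  have := isProbabilityMeasure_expMeasure one_pos
  have h1 : MeasurePreserving (fun (a : ℕ → ℝ) k => a k / q)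
      (Measure.infinitePi fun _ : ℕ => expMeasure 1)
      (Measure.infinitePi fun _ : ℕ => expMeasure q) := by
    refine ⟨by fun_prop, ?_⟩
    rw [Measure.infinitePi_map_pi (f := fun _ x => x / q) _ (by fun_prop)]
    simp only [(measurePreserving_div_expMeasure hq).map_eq]
  have h2 : MeasurePreserving (fun z : ℝ × (ℕ → ℝ) => (z.1 / p, z.2))
      ((expMeasure 1).prod (Measure.infinitePi fun _ : ℕ => expMeasure 1))
      ((expMeasure p).prod (Measure.infinitePi fun _ : ℕ => expMeasure 1)) :=
    (measurePreserving_div_expMeasure hp).prod (MeasurePreserving.id _)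
  have h3 : MeasurePreserving (fun (a : ℕ → ℝ × (ℕ → ℝ)) k => ((a k).1 / p, (a k).2))
      (Measure.infinitePi fun _ : ℕ =>
        (expMeasure 1).prod (Measure.infinitePi fun _ : ℕ => expMeasure 1))
      (Measure.infinitePi fun _ : ℕ =>
        (expMeasure p).prod (Measure.infinitePi fun _ : ℕ => expMeasure 1)) := by
    refine ⟨by fun_prop, ?_⟩
    rw [Measure.infinitePi_map_pi (f := fun _ (z : ℝ × (ℕ → ℝ)) => (z.1 / p, z.2)) _ (by fun_prop)]
    simp only [h2.map_eq]
  exact h1.prod h3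

/-! ### Up-right walks in the quadrant -/

/-- The up-right walk in `ℕ²` from the origin whose `n`-th step goes right if `s n` holds and up
otherwise. -/
def walk (s : ℕ → Bool) : ℕ → ℕ × ℕ
  | 0 => (0, 0)
  | n + 1 => if s n then ((walk s n).1 + 1, (walk s n).2) else ((walk s n).1, (walk s n).2 + 1)

lemma walk_zero (s : ℕ → Bool) : walk s 0 = 0 := rfl

lemma walk_fst_add_snd (s : ℕ → Bool) (n : ℕ) : (walk s n).1 + (walk s n).2 = n := by
  induction n with
  | zero => rfl
  | succ n ih =>
    rw [walk]
    split_ifs <;> simp only <;> omega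

/-- The walk with steps `s` is a geodesic from the origin in the environment `ω` on the quadrant:
none of its finite segments can be replaced by a heavier up-right path. As in `pathWeight`, the
end points of a segment do not count. -/
def IsGeodesicWalk (ω : ℕ → ℕ → ℝ) (s : ℕ → Bool) : Prop :=
  ∀ (m n : ℕ) (s' : ℕ → Bool), walk s m + walk s' n = walk s (m + n) →
    ∑ k ∈ Finset.Ioo 0 n, Function.uncurry ω (walk s m + walk s' k) ≤
      ∑ k ∈ Finset.Ioo 0 n, Function.uncurry ω (walk s (m + k))

/-- The site of `ℤ²` at displacement `x` from `u`. -/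
def site (u : ℤ × ℤ) (x : ℕ × ℕ) : ℤ × ℤ := (u.1 + x.1, u.2 + x.2)

lemma isStep_site_walk (u : ℤ × ℤ) (s : ℕ → Bool) (n : ℕ) :
    IsStep (site u (walk s n)) (site u (walk s (n + 1))) := by
  rw [walk]
  split_ifs
  · left; ext <;> simp [site]; ring
  · right; ext <;> simp [site]; ring

lemma exists_walk_of_isUpRightPath {u v : ℤ × ℤ} {a : ℕ × ℕ} {n : ℕ} {γ : ℕ → ℤ × ℤ}
    (h : IsUpRightPath (site u a) v n γ) :
    ∃ s : ℕ → Bool, ∀ k ≤ n, γ k = site u (a + walk s k) := by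
  classical
  refine ⟨fun k => decide (γ (k + 1) = γ k + (1, 0)), fun k => ?_⟩
  induction k with
  | zero => intro _; simp [walk, h.start, site]
  | succ k ih =>
    intro hk
    have hγ := ih (by omega)
    rw [walk]
    split_ifs with hs
    · rw [of_decide_eq_true hs, hγ]
      ext <;> simp [site]; ring
    · have : γ (k + 1) = γ k + (0, 1) := (h.step k (by omega)).resolve_left (by simpa using hs)
      rw [this, hγ]
      ext <;> simp [site]; ring

/-- A geodesic walk of the environment seen from `u` is a semi-infinite geodesic from `u`. -/
lemma IsGeodesicWalk.isSemiInfiniteGeodesic {τ : ℤ × ℤ → ℝ} {u : ℤ × ℤ} {s : ℕ → Bool}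
    (h : IsGeodesicWalk (fun i j => τ (site u (i, j))) s) :
    IsSemiInfiniteGeodesic τ u (fun n => site u (walk s n)) where
  start := by simp [walk, site]
  step := isStep_site_walk u s
  geodesic := by
    refine fun m n => ⟨⟨rfl, rfl, fun k _ => isStep_site_walk u s (m + k)⟩, fun n' γ' hγ' => ?_⟩
    obtain ⟨s', hs'⟩ := exists_walk_of_isUpRightPath hγ'
    have hend : walk s m + walk s' n' = walk s (m + n) := by
      have h1 := hs' n' le_rfl
      rw [hγ'.finish] at h1
      have h2 := congrArg Prod.fst h1
      have h3 := congrArg Prod.snd h1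
      simp only [site, Prod.fst_add, Prod.snd_add] at h2 h3
      ext
      · simp only [Prod.fst_add]; omega
      · simp only [Prod.snd_add]; omega
    have hn : n' = n := by
      have h1 := walk_fst_add_snd s m
      have h2 := walk_fst_add_snd s' n'
      have h3 := walk_fst_add_snd s (m + n)
      rw [← hend] at h3
      simp only [Prod.fst_add, Prod.snd_add] at h3
      omega
    subst hn
    have key := h m n' s' hend
    simp only [pathWeight]
    refine le_of_eq_of_le (Finset.sum_congr rfl fun k hk => ?_) key
    rw [hs' k (Finset.mem_Ioo.mp hk).2.le]
    rfl

lemma hasDirection_of_tendsto {u : ℤ × ℤ} {s : ℕ → Bool} {α : ℝ}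
    (hα : α ∈ Set.Ioo 0 (Real.pi / 2))
    (h : Tendsto (fun n : ℕ => ((walk s n).1 : ℝ) / n * (Real.cos α + Real.sin α) - Real.cos α)
      atTop (𝓝 0)) :
    HasDirection (fun n => site u (walk s n)) α := by
  have hc : 0 < Real.cos α := Real.cos_pos_of_mem_Ioo ⟨by linarith [hα.1, Real.pi_pos], hα.2⟩
  have hs : 0 < Real.sin α := Real.sin_pos_of_pos_of_lt_pi hα.1 (by linarith [hα.2, Real.pi_pos])
  set S := Real.cos α + Real.sin α with hS
  have hSpos : 0 < S := by positivity
  have hx : Tendsto (fun n : ℕ => ((walk s n).1 : ℝ) / n) atTop (𝓝 (Real.cos α / S)) := by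
    have h1 := (h.add_const (Real.cos α)).div_const S
    rw [zero_add] at h1
    refine h1.congr fun n => ?_
    field_simp
    ring
  have hy : Tendsto (fun n : ℕ => ((walk s n).2 : ℝ) / n) atTop (𝓝 (Real.sin α / S)) := by
    have h1 : Tendsto (fun n : ℕ => 1 - ((walk s n).1 : ℝ) / n) atTop
        (𝓝 (1 - Real.cos α / S)) := hx.const_sub 1
    rw [show 1 - Real.cos α / S = Real.sin α / S by field_simp; rw [hS]; ring] at h1
    refine h1.congr' ?_
    filter_upwards [eventually_gt_atTop 0] with n hn
    have hn' : (0 : ℝ) < n := by exact_mod_cast hn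
    have hsum : ((walk s n).1 : ℝ) + (walk s n).2 = n := by exact_mod_cast walk_fst_add_snd s n
    field_simp
    linarith
  have hu : ∀ c : ℤ, Tendsto (fun n : ℕ => (c : ℝ) / n) atTop (𝓝 0) := fun c =>
    tendsto_const_div_atTop_nhds_zero_nat (c : ℝ)
  have hX : Tendsto (fun n : ℕ => ((site u (walk s n)).1 : ℝ) / n) atTop
      (𝓝 (Real.cos α / S)) := by
    have := (hu u.1).add hx
    rw [zero_add] at this
    refine this.congr fun n => ?_
    simp [site, add_div]
  have hY : Tendsto (fun n : ℕ => ((site u (walk s n)).2 : ℝ) / n) atTop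
      (𝓝 (Real.sin α / S)) := by
    have := (hu u.2).add hy
    rw [zero_add] at this
    refine this.congr fun n => ?_
    simp [site, add_div]
  have hR : Tendsto (fun n : ℕ => √((((site u (walk s n)).1 : ℝ) / n) ^ 2 +
      (((site u (walk s n)).2 : ℝ) / n) ^ 2)) atTop (𝓝 (1 / S)) := by
    have := ((hX.pow 2).add (hY.pow 2)).sqrt
    rw [show (Real.cos α / S) ^ 2 + (Real.sin α / S) ^ 2 = (1 / S) ^ 2 by
      rw [div_pow, div_pow, ← add_div, Real.cos_sq_add_sin_sq, div_pow, one_pow],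
      Real.sqrt_sq (by positivity)] at this
    exact this
  have hSne : (1 / S : ℝ) ≠ 0 := by positivity
  have hfin := (hX.div hR hSne).prodMk_nhds (hY.div hR hSne)
  rw [div_div_div_cancel_right₀ hSpos.ne', div_div_div_cancel_right₀ hSpos.ne', div_one,
    div_one] at hfin
  refine hfin.congr' ?_
  filter_upwards [eventually_gt_atTop 0] with n hn
  have hn' : (0 : ℝ) < n := by exact_mod_cast hn
  have hroot : √((((site u (walk s n)).1 : ℝ) / n) ^ 2 + (((site u (walk s n)).2 : ℝ) / n) ^ 2)
      = √(((site u (walk s n)).1 : ℝ) ^ 2 + ((site u (walk s n)).2 : ℝ) ^ 2) / n := by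
    rw [div_pow, div_pow, ← add_div, Real.sqrt_div' _ (by positivity), Real.sqrt_sq hn'.le]
  simp only [Pi.div_apply]
  rw [hroot, div_div_div_cancel_right₀ hn'.ne', div_div_div_cancel_right₀ hn'.ne']

/-! ### The greedy geodesic of the dual weights -/

/-- The walk that always takes the step with the smaller increment (the competition interface of
the stationary model). -/
noncomputable def greedy (z : Noise) : ℕ → ℕ × ℕ
  | 0 => (0, 0)
  | n + 1 =>
    if rightIncrement z (greedy z n).1 (greedy z n).2 ≤ upIncrement z (greedy z n).1 (greedy z n).2
    then ((greedy z n).1 + 1, (greedy z n).2) else ((greedy z n).1, (greedy z n).2 + 1)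

/-- The steps of the greedy walk. -/
noncomputable def greedySteps (z : Noise) (n : ℕ) : Bool :=
  decide (rightIncrement z (greedy z n).1 (greedy z n).2 ≤
    upIncrement z (greedy z n).1 (greedy z n).2)

lemma walk_greedySteps (z : Noise) (n : ℕ) : walk (greedySteps z) n = greedy z n := by
  induction n with
  | zero => rfl
  | succ n ih => simp [walk, greedy, greedySteps, ih]

/-- The height increases along every up-right path by at least the dual weights on it. -/
lemma sum_dualWeight_le_height (z : Noise) (a : ℕ × ℕ) (s : ℕ → Bool) (n : ℕ) :
    ∑ k ∈ Finset.range n, Function.uncurry (dualWeight z) (a + walk s k) ≤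
      Function.uncurry (height z) (a + walk s n) - Function.uncurry (height z) a := by
  induction n with
  | zero => simp [walk_zero]
  | succ n ih =>
    rw [Finset.sum_range_succ]
    have hstep : Function.uncurry (height z) (a + walk s n) +
        Function.uncurry (dualWeight z) (a + walk s n) ≤
          Function.uncurry (height z) (a + walk s (n + 1)) := by
      rw [walk]
      split_ifs
      · simp only [Function.uncurry, Prod.fst_add, Prod.snd_add, ← add_assoc, height_succ_right]
        rw [dualWeight_eq_min]
        gcongr
        exact min_le_left _ _
      · simp only [Function.uncurry, Prod.fst_add, Prod.snd_add, ← add_assoc, height_succ_up]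
        rw [dualWeight_eq_min]
        gcongr
        exact min_le_right _ _
    linarith

/-- Along the greedy walk the height increases exactly by the dual weights. -/
lemma sum_dualWeight_greedy (z : Noise) (m n : ℕ) :
    ∑ k ∈ Finset.range n, Function.uncurry (dualWeight z) (greedy z (m + k)) =
      Function.uncurry (height z) (greedy z (m + n)) -
        Function.uncurry (height z) (greedy z m) := by
  induction n with
  | zero => simp
  | succ n ih =>
    rw [Finset.sum_range_succ, ih, ← add_assoc, greedy]
    split_ifs with h
    · simp only [Function.uncurry, height_succ_right]
      rw [dualWeight_eq_min, min_eq_left h]; ring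
    · simp only [Function.uncurry, height_succ_up]
      rw [dualWeight_eq_min, min_eq_right (not_le.mp h).le]; ring

lemma isGeodesicWalk_greedySteps (z : Noise) : IsGeodesicWalk (dualWeight z) (greedySteps z) := by
  intro m n s' hend
  simp only [walk_greedySteps] at hend ⊢
  have h1 := sum_dualWeight_le_height z (greedy z m) s' n
  rw [hend, ← sum_dualWeight_greedy] at h1
  cases n with
  | zero => simp
  | succ n =>
    have hsplit : ∀ f : ℕ → ℝ, ∑ k ∈ Finset.range (n + 1), f k
        = f 0 + ∑ k ∈ Finset.Ioo 0 (n + 1), f k := by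
      intro f
      rw [Finset.range_eq_Ico, ← Finset.Ioo_insert_left (by omega : 0 < n + 1),
        Finset.sum_insert (by simp)]
    rw [hsplit, hsplit] at h1
    simpa [walk_zero] using h1

lemma measurable_greedy (n : ℕ) : Measurable fun z => greedy z n := by
  induction n with
  | zero => exact measurable_const
  | succ n ih =>
    have hincr : ∀ f : Noise → ℕ → ℕ → ℝ, (∀ m k, Measurable fun z => f z m k) →
        Measurable fun z => f z (greedy z n).1 (greedy z n).2 := by
      intro f hf
      have : Measurable fun y : Noise × (ℕ × ℕ) => f y.1 y.2.1 y.2.2 :=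
        measurable_from_prod_countable_left fun x => hf x.1 x.2
      exact this.comp (measurable_id.prodMk ih)
    have hset : MeasurableSet {z | rightIncrement z (greedy z n).1 (greedy z n).2 ≤
        upIncrement z (greedy z n).1 (greedy z n).2} :=
      measurableSet_le (hincr _ measurable_rightIncrement) (hincr _ measurable_upIncrement)
    exact Measurable.ite hset ((ih.fst.add_const 1).prodMk ih.snd)
      (ih.fst.prodMk (ih.snd.add_const 1))

/-! ### Compactness of the space of walks -/

lemma continuous_walk (n : ℕ) : Continuous fun s : ℕ → Bool => walk s n := by
  induction n with
  | zero => exact continuous_const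
  | succ n ih =>
    have hg : Continuous fun y : Bool × (ℕ × ℕ) =>
        if y.1 then (y.2.1 + 1, y.2.2) else (y.2.1, y.2.2 + 1) := continuous_of_discreteTopology
    exact hg.comp ((continuous_apply n).prodMk ih)

lemma continuous_uncurry_comp {Y : Type*} [TopologicalSpace Y] {f : Y → ℕ × ℕ}
    (hf : Continuous f) :
    Continuous fun z : (ℕ → ℕ → ℝ) × Y => Function.uncurry z.1 (f z.2) := by
  have h : Continuous fun y : (ℕ → ℕ → ℝ) × (ℕ × ℕ) => Function.uncurry y.1 y.2 :=
    continuous_prod_of_discrete_right.mpr fun x => by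
      simp only [Function.uncurry]; fun_prop
  exact h.comp (continuous_fst.prodMk (hf.comp continuous_snd))

lemma measurableSet_exists_heavy_walk (N : ℕ) (x : ℕ × ℕ) (a : ℝ) :
    MeasurableSet {ω : ℕ → ℕ → ℝ | ∃ s : ℕ → Bool, walk s N = x ∧
      a ≤ ∑ j ∈ Finset.range N, Function.uncurry ω (walk s j)} := by
  have hcl : IsClosed {y : (ℕ → ℕ → ℝ) × (ℕ → Bool) | walk y.2 N = x ∧
      a ≤ ∑ j ∈ Finset.range N, Function.uncurry y.1 (walk y.2 j)} := by
    refine IsClosed.and (isClosed_eq ((continuous_walk N).comp continuous_snd)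
      continuous_const) (isClosed_le continuous_const ?_)
    exact continuous_finsetSum _ fun j _ => continuous_uncurry_comp (continuous_walk j)
  have := (isClosedMap_fst_of_compactSpace _ hcl).measurableSet
  convert! this using 1
  ext ω
  simp

/-! ### The direction of the greedy geodesic -/

lemma exists_height_tail {p q δ : ℝ} (hp : 0 < p) (hq : 0 < q) (hpq : p + q = 1) (hδ : 0 < δ) :
    ∃ κ > 0, ∀ (N : ℕ) (x : ℕ × ℕ), x.1 + x.2 = N →
      stationaryNoise p q {z | x.1 / p + x.2 / q + δ * N ≤ height z x.1 x.2} ≤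
        2 * ENNReal.ofReal (Real.exp (-κ * N)) ∧
      stationaryNoise p q {z | height z x.1 x.2 ≤ x.1 / p + x.2 / q - δ * N} ≤
        2 * ENNReal.ofReal (Real.exp (-κ * N)) := by
  obtain ⟨κ₁, hκ₁, h₁⟩ := exists_exp_sum_tail hp (half_pos hδ)
  obtain ⟨κ₂, hκ₂, h₂⟩ := exists_exp_sum_tail hq (half_pos hδ)
  refine ⟨min κ₁ κ₂, lt_min hκ₁ hκ₂, fun N x hx => ?_⟩
  have hle₁ : ENNReal.ofReal (Real.exp (-κ₁ * N)) ≤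
      ENNReal.ofReal (Real.exp (-(min κ₁ κ₂) * N)) := by
    gcongr; exact min_le_left _ _
  have hle₂ : ENNReal.ofReal (Real.exp (-κ₂ * N)) ≤
      ENNReal.ofReal (Real.exp (-(min κ₁ κ₂) * N)) := by
    gcongr; exact min_le_right _ _
  have hb := measurePreserving_bottom hp hq
  have hu := measurePreserving_upIncrement hp hq hpq x.1
  have hms : ∀ m : ℕ, Measurable fun a : ℕ → ℝ => ∑ i ∈ Finset.range m, a i := by
    intro m; fun_prop
  obtain ⟨hb1, hb2⟩ := h₁ N x.1 (by omega)
  obtain ⟨hu1, hu2⟩ := h₂ N x.2 (by omega)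
  rw [← hb.measure_preimage (measurableSet_le measurable_const (hms _)).nullMeasurableSet] at hb1
  rw [← hb.measure_preimage (measurableSet_le (hms _) measurable_const).nullMeasurableSet] at hb2
  rw [← hu.measure_preimage (measurableSet_le measurable_const (hms _)).nullMeasurableSet] at hu1
  rw [← hu.measure_preimage (measurableSet_le (hms _) measurable_const).nullMeasurableSet] at hu2
  constructor
  · rw [two_mul]
    refine (measure_mono ?_).trans ((measure_union_le _ _).trans
      (add_le_add (hb1.trans hle₁) (hu1.trans hle₂)))
    intro z hz
    simp only [Set.mem_union, Set.mem_preimage, Set.mem_ofPred_eq, height] at hz ⊢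
    by_contra! hcon
    linarith [hcon.1, hcon.2]
  · rw [two_mul]
    refine (measure_mono ?_).trans ((measure_union_le _ _).trans
      (add_le_add (hb2.trans hle₁) (hu2.trans hle₂)))
    intro z hz
    simp only [Set.mem_union, Set.mem_preimage, Set.mem_ofPred_eq, height] at hz ⊢
    by_contra! hcon
    linarith [hcon.1, hcon.2]

/-- The greedy walk of the model with parameters `p, q` avoids the sites where the mean height
exceeds the mean height of the model with parameters `p', q'` by a linear amount: the weight of the
greedy walk equals the height in the first model, while every up-right path in an i.i.d.
environment weighs at most the height in the second one. -/
lemma ae_eventually_greedy_avoids {p q p' q' δ : ℝ} (hp : 0 < p) (hq : 0 < q) (hpq : p + q = 1)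
    (hp' : 0 < p') (hq' : 0 < q') (hpq' : p' + q' = 1) (hδ : 0 < δ) (T : ℕ × ℕ → Prop)
    (hT : ∀ x, T x → x.1 / p' + x.2 / q' + 2 * δ * (x.1 + x.2 : ℝ) ≤ x.1 / p + x.2 / q) :
    ∀ᵐ z ∂(stationaryNoise p q), ∀ᶠ N in atTop, ¬ T (greedy z N) := by
  obtain ⟨κ₁, hκ₁, h₁⟩ := exists_height_tail hp hq hpq hδ
  obtain ⟨κ₂, hκ₂, h₂⟩ := exists_height_tail hp' hq' hpq' hδ
  set κ := min κ₁ κ₂ with hκ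
  have hκpos : 0 < κ := lt_min hκ₁ hκ₂
  have hle₁ : ∀ N : ℕ, ENNReal.ofReal (Real.exp (-κ₁ * N)) ≤
      ENNReal.ofReal (Real.exp (-κ * N)) := by
    intro N; gcongr; exact min_le_left _ _
  have hle₂ : ∀ N : ℕ, ENNReal.ofReal (Real.exp (-κ₂ * N)) ≤
      ENNReal.ofReal (Real.exp (-κ * N)) := by
    intro N; gcongr; exact min_le_right _ _
  have hbound : ∀ N : ℕ, stationaryNoise p q {z | T (greedy z N)} ≤
      ENNReal.ofReal (4 * ((N + 1) * Real.exp (-κ * N))) := by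
    intro N
    set D : ℕ × ℕ → Set (ℕ → ℕ → ℝ) := fun x => {ω | ∃ s : ℕ → Bool, walk s N = x ∧
      x.1 / p' + x.2 / q' + δ * N ≤ ∑ j ∈ Finset.range N, Function.uncurry ω (walk s j)} with hD
    have hsub : {z | T (greedy z N)} ⊆ ⋃ x ∈ Finset.HasAntidiagonal.antidiagonal N,
        ({z | height z x.1 x.2 ≤ x.1 / p + x.2 / q - δ * N} ∪ dualWeight ⁻¹' D x) := by
      intro z hz
      have hz' : T (greedy z N) := hz
      have hsum : (greedy z N).1 + (greedy z N).2 = N := by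
        rw [← walk_greedySteps]; exact walk_fst_add_snd _ _
      have hsumR : ((greedy z N).1 : ℝ) + (greedy z N).2 = N := by exact_mod_cast hsum
      simp only [Set.mem_iUnion]
      refine ⟨greedy z N, Finset.HasAntidiagonal.mem_antidiagonal.mpr hsum, ?_⟩
      by_cases hh : height z (greedy z N).1 (greedy z N).2 ≤
          (greedy z N).1 / p + (greedy z N).2 / q - δ * N
      · exact Or.inl hh
      · right
        refine ⟨greedySteps z, walk_greedySteps z N, ?_⟩
        simp only [walk_greedySteps]
        have h := sum_dualWeight_greedy z 0 N
        simp only [zero_add] at h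
        rw [h]
        have h0 : Function.uncurry (height z) (greedy z 0) = 0 := by
          simp [greedy, Function.uncurry, height]
        have hTz := hT _ hz'
        rw [hsumR] at hTz
        rw [h0]
        simp only [Function.uncurry]
        push Not at hh
        linarith
    have hDle : ∀ x ∈ Finset.HasAntidiagonal.antidiagonal N,
        stationaryNoise p q (dualWeight ⁻¹' D x) ≤ 2 * ENNReal.ofReal (Real.exp (-κ * N)) := by
      intro x hx
      have hDm : MeasurableSet (D x) := measurableSet_exists_heavy_walk _ _ _
      -- both models have the same law of dual weights, so the bound can be proved in the second one
      rw [(measurePreserving_dualWeight hp hq hpq).measure_preimage hDm.nullMeasurableSet,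
        ← (measurePreserving_dualWeight hp' hq' hpq').measure_preimage hDm.nullMeasurableSet]
      refine le_trans (measure_mono ?_)
        (((h₂ N x (Finset.HasAntidiagonal.mem_antidiagonal.mp hx)).1).trans
          (mul_le_mul_right (hle₂ N) _))
      rintro z ⟨s, hs, hsum⟩
      have h := sum_dualWeight_le_height z 0 s N
      simp only [zero_add, hs] at h
      have h0 : Function.uncurry (height z) (0 : ℕ × ℕ) = 0 := by
        simp [Function.uncurry, height]
      rw [h0] at h
      simp only [Set.mem_ofPred_eq]
      exact hsum.trans (by simpa [Function.uncurry] using h)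
    calc stationaryNoise p q {z | T (greedy z N)}
        ≤ ∑ x ∈ Finset.HasAntidiagonal.antidiagonal N, stationaryNoise p q
          ({z | height z x.1 x.2 ≤ x.1 / p + x.2 / q - δ * N} ∪ dualWeight ⁻¹' D x) :=
        (measure_mono hsub).trans (measure_biUnion_finset_le _ _)
      _ ≤ ∑ x ∈ Finset.HasAntidiagonal.antidiagonal N, 4 * ENNReal.ofReal (Real.exp (-κ * N)) := by
        refine Finset.sum_le_sum fun x hx => (measure_union_le _ _).trans ?_
        calc _ ≤ 2 * ENNReal.ofReal (Real.exp (-κ * N)) +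
              2 * ENNReal.ofReal (Real.exp (-κ * N)) :=
            add_le_add (((h₁ N x (Finset.HasAntidiagonal.mem_antidiagonal.mp hx)).2).trans
              (mul_le_mul_right (hle₁ N) _)) (hDle x hx)
          _ = _ := by rw [← add_mul]; norm_num
      _ = ENNReal.ofReal (4 * ((N + 1) * Real.exp (-κ * N))) := by
        rw [Finset.sum_const, Finset.Nat.card_antidiagonal, nsmul_eq_mul,
          ENNReal.ofReal_mul (by norm_num), ENNReal.ofReal_mul (by positivity),
          ENNReal.ofReal_add (by positivity) (by norm_num)]
        simp
        ring
  have hsummable : Summable fun N : ℕ => 4 * (((N : ℝ) + 1) * Real.exp (-κ * N)) := by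
    have h1 := Real.summable_pow_mul_exp_neg_nat_mul 1 hκpos
    have h0 := Real.summable_pow_mul_exp_neg_nat_mul 0 hκpos
    refine ((h1.add h0).mul_left 4).congr fun N => ?_
    ring
  have htsum : ∑' N : ℕ, stationaryNoise p q {z | T (greedy z N)} ≠ ∞ := by
    refine ne_top_of_le_ne_top ?_ (ENNReal.tsum_le_tsum hbound)
    rw [← ENNReal.ofReal_tsum_of_nonneg (fun N => by positivity) hsummable]
    exact ENNReal.ofReal_ne_top
  exact ae_eventually_notMem htsum

/-- The greedy walk has an asymptotic slope. The mean heights `x₁ / p' + x₂ / q'` of the models with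
`p' + q' = 1` have as lower envelope `(√x₁ + √x₂)²`, which the model with parameters `p, q` touches
only in the direction `(p², q²)`. -/
lemma ae_tendsto_greedy {p q : ℝ} (hp : 0 < p) (hq : 0 < q) (hpq : p + q = 1) :
    ∀ᵐ z ∂(stationaryNoise p q),
      Tendsto (fun N : ℕ => ((greedy z N).1 : ℝ) / N) atTop (𝓝 (p ^ 2 / (p ^ 2 + q ^ 2))) := by
  set c := p ^ 2 / (p ^ 2 + q ^ 2) with hc
  obtain rfl : q = 1 - p := by linarith
  -- `(l - p) * φ t l` is the excess, per step, of the mean height with parameter `p` over the one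
  -- with parameter `l` on the ray where the fraction of right steps is `t`
  set φ : ℝ → ℝ → ℝ := fun t l =>
    t * (1 / (p * l) + 1 / ((1 - p) * (1 - l))) - 1 / ((1 - p) * (1 - l)) with hφ
  have hφc : ∀ t, ContinuousAt (φ t) p := by
    intro t
    have h1 : p * p ≠ 0 := by positivity
    have h2 : (1 - p) * (1 - p) ≠ 0 := by positivity
    have h3 : ContinuousAt (fun l : ℝ => 1 / (p * l)) p :=
      continuousAt_const.div (by fun_prop) h1
    have h4 : ContinuousAt (fun l : ℝ => 1 / ((1 - p) * (1 - l))) p :=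
      continuousAt_const.div (by fun_prop) h2
    exact (continuousAt_const.mul (h3.add h4)).sub h4
  have hφp : ∀ t, φ t p = (t - c) * (1 / (p * p) + 1 / ((1 - p) * (1 - p))) := by
    intro t
    have : p ^ 2 + (1 - p) ^ 2 ≠ 0 := by positivity
    simp only [hφ, hc]
    field_simp
    ring
  have hpos : 0 < 1 / (p * p) + 1 / ((1 - p) * (1 - p)) := by positivity
  have hdiff : ∀ (l : ℝ) (x : ℕ × ℕ), 0 < l → l < 1 →
      (x.1 / p + x.2 / (1 - p) : ℝ) - (x.1 / l + x.2 / (1 - l)) = (l - p) *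
        (x.1 * (1 / (p * l) + 1 / ((1 - p) * (1 - l))) -
          (x.1 + x.2) * (1 / ((1 - p) * (1 - l)))) := by
    intro l x h0 h1
    have : 1 - l ≠ 0 := by linarith
    have : 1 - p ≠ 0 := by linarith
    field_simp
    ring
  have hAB : ∀ l, 0 < l → l < 1 → 0 < 1 / (p * l) + 1 / ((1 - p) * (1 - l)) := by
    intro l h0 h1
    have : 0 < 1 - l := by linarith
    positivity
  have hupper : ∀ η > 0, ∀ᵐ z ∂(stationaryNoise p (1 - p)), ∀ᶠ N in atTop,
      ¬ (c + η) * ((greedy z N).1 + (greedy z N).2 : ℝ) ≤ (greedy z N).1 := by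
    intro η hη
    have hev : ∀ᶠ l in 𝓝 p, 0 < φ (c + η) l := (hφc _).eventually_const_lt (by
      rw [hφp]; exact mul_pos (by linarith) hpos)
    obtain ⟨l, ⟨hl1, hl2⟩, hl3⟩ :=
      ((hev.and (eventually_lt_nhds (show p < 1 by linarith))).filter_mono
        nhdsWithin_le_nhds |>.and (self_mem_nhdsWithin (s := Set.Ioi p))).exists
    have hl3' : p < l := hl3
    have hd : 0 < (l - p) * φ (c + η) l := mul_pos (by linarith) hl1
    refine ae_eventually_greedy_avoids hp hq hpq (hp.trans hl3') (by linarith : 0 < 1 - l)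
      (by ring) (half_pos hd)
      (fun x => (c + η) * (x.1 + x.2 : ℝ) ≤ x.1) fun x hx => ?_
    have h1 := hdiff l x (hp.trans hl3') hl2
    have h2 := mul_le_mul_of_nonneg_right hx (hAB l (hp.trans hl3') hl2).le
    have h3 : (x.1 + x.2 : ℝ) * φ (c + η) l ≤
        x.1 * (1 / (p * l) + 1 / ((1 - p) * (1 - l))) -
          (x.1 + x.2) * (1 / ((1 - p) * (1 - l))) := by
      simp only [hφ]; linarith
    have h4 := mul_le_mul_of_nonneg_left h3 (by linarith : 0 ≤ l - p)
    rw [← h1] at h4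
    linarith
  have hlower : ∀ η > 0, ∀ᵐ z ∂(stationaryNoise p (1 - p)), ∀ᶠ N in atTop,
      ¬ ((greedy z N).1 : ℝ) ≤ (c - η) * ((greedy z N).1 + (greedy z N).2 : ℝ) := by
    intro η hη
    have hev : ∀ᶠ l in 𝓝 p, φ (c - η) l < 0 := (hφc _).eventually_lt_const (by
      rw [hφp]; exact mul_neg_of_neg_of_pos (by linarith) hpos)
    obtain ⟨l, ⟨hl1, hl2⟩, hl3⟩ := ((hev.and (eventually_gt_nhds hp)).filter_mono
      nhdsWithin_le_nhds |>.and (self_mem_nhdsWithin (s := Set.Iio p))).exists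
    have hl3' : l < p := hl3
    have hd : 0 < (l - p) * φ (c - η) l := mul_pos_of_neg_of_neg (by linarith) hl1
    refine ae_eventually_greedy_avoids hp hq hpq hl2 (by linarith : 0 < 1 - l)
      (by ring) (half_pos hd)
      (fun x => (x.1 : ℝ) ≤ (c - η) * (x.1 + x.2 : ℝ)) fun x hx => ?_
    have h1 := hdiff l x hl2 (by linarith)
    have h2 := mul_le_mul_of_nonneg_right hx (hAB l hl2 (by linarith)).le
    have h3 : x.1 * (1 / (p * l) + 1 / ((1 - p) * (1 - l))) -
          (x.1 + x.2) * (1 / ((1 - p) * (1 - l))) ≤ (x.1 + x.2 : ℝ) * φ (c - η) l := by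
      simp only [hφ]; linarith
    have h4 := mul_le_mul_of_nonpos_left h3 (by linarith : l - p ≤ 0)
    rw [← h1] at h4
    linarith
  have hall : ∀ᵐ z ∂(stationaryNoise p (1 - p)), ∀ j : ℕ, ∀ᶠ N in atTop,
      (¬ (c + 1 / ((j : ℝ) + 1)) * ((greedy z N).1 + (greedy z N).2 : ℝ) ≤ (greedy z N).1) ∧
      ¬ ((greedy z N).1 : ℝ) ≤ (c - 1 / ((j : ℝ) + 1)) * ((greedy z N).1 + (greedy z N).2 : ℝ) := by
    rw [ae_all_iff]
    intro j
    have hj : 0 < 1 / ((j : ℝ) + 1) := by positivity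
    filter_upwards [hupper _ hj, hlower _ hj] with z h1 h2 using h1.and h2
  filter_upwards [hall] with z hz
  rw [Metric.tendsto_atTop']
  intro ε hε
  obtain ⟨j, hj⟩ := exists_nat_one_div_lt hε
  obtain ⟨N₀, hN₀⟩ := eventually_atTop.mp (hz j)
  refine ⟨N₀, fun N hN => ?_⟩
  obtain ⟨h1, h2⟩ := hN₀ N hN.le
  have hsum : ((greedy z N).1 : ℝ) + (greedy z N).2 = N := by
    rw [← walk_greedySteps]; exact_mod_cast walk_fst_add_snd _ _
  rw [hsum] at h1 h2
  push Not at h1 h2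
  have hNpos : (0 : ℝ) < N := by exact_mod_cast (Nat.zero_le N₀).trans_lt hN
  rw [Real.dist_eq, abs_lt]
  constructor
  · rw [lt_sub_iff_add_lt, lt_div_iff₀ hNpos]
    exact (mul_le_mul_of_nonneg_right (by linarith) hNpos.le).trans_lt h2
  · rw [sub_lt_iff_lt_add, div_lt_iff₀ hNpos]
    exact h1.trans_le (mul_le_mul_of_nonneg_right (by linarith) hNpos.le)

/-! ### Geodesics in a random direction -/

/-- The law of i.i.d. `Exp(1)` weights on the quadrant. -/
noncomputable abbrev quadrantLaw : Measure (ℕ → ℕ → ℝ) :=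
  Measure.infinitePi fun _ : ℕ => Measure.infinitePi fun _ : ℕ => expMeasure 1

/-- The rate of the horizontal increments of the stationary model with characteristic
direction `α`. -/
noncomputable def rightRate (α : ℝ) : ℝ :=
  √(Real.cos α) / (√(Real.cos α) + √(Real.sin α))

/-- The rate of the vertical increments of the stationary model with characteristic
direction `α`. -/
noncomputable def upRate (α : ℝ) : ℝ :=
  √(Real.sin α) / (√(Real.cos α) + √(Real.sin α))

lemma rates_spec {α : ℝ} (hα : α ∈ Set.Ioo 0 (Real.pi / 2)) :
    0 < rightRate α ∧ 0 < upRate α ∧ rightRate α + upRate α = 1 ∧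
      rightRate α ^ 2 / (rightRate α ^ 2 + upRate α ^ 2) * (Real.cos α + Real.sin α)
        = Real.cos α := by
  have hc : 0 < Real.cos α := Real.cos_pos_of_mem_Ioo ⟨by linarith [hα.1, Real.pi_pos], hα.2⟩
  have hs : 0 < Real.sin α := Real.sin_pos_of_pos_of_lt_pi hα.1 (by linarith [hα.2, Real.pi_pos])
  have hc' := Real.sqrt_pos.mpr hc
  have hs' := Real.sqrt_pos.mpr hs
  refine ⟨div_pos hc' (by positivity), div_pos hs' (by positivity), ?_, ?_⟩
  · rw [rightRate, upRate]
    field_simp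
  · rw [rightRate, upRate, div_pow, div_pow, Real.sq_sqrt hc.le, Real.sq_sqrt hs.le]
    field_simp

/-- The noise of the stationary model with characteristic direction `y.1`. -/
noncomputable def directedNoise (y : ℝ × Noise) : Noise :=
  rescale (rightRate y.1) (upRate y.1) y.2

lemma measurable_directedNoise : Measurable directedNoise := by
  unfold directedNoise rescale rightRate upRate
  fun_prop

lemma measurable_dualWeight : Measurable dualWeight :=
  measurable_pi_iff.mpr fun m => measurable_runOut measurable_columnStep m

/-- The deviation of the `n`-th point `x` of a walk from direction `α`. Multiplying the slope
`x.1 / n` by `cos α + sin α`, instead of dividing `cos α` by it, keeps this continuous in `α`. -/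
noncomputable def deviation (α : ℝ) (x : ℕ × ℕ) (n : ℕ) : ℝ :=
  (x.1 : ℝ) / n * (Real.cos α + Real.sin α) - Real.cos α

lemma measurePreserving_directed_dualWeight {ν : Measure ℝ} [IsProbabilityMeasure ν]
    (hν : ∀ᵐ α ∂ν, α ∈ Set.Ioo 0 (Real.pi / 2)) :
    MeasurePreserving (fun y : ℝ × Noise => (y.1, dualWeight (directedNoise y)))
      (ν.prod (stationaryNoise 1 1)) (ν.prod quadrantLaw) := by
  have := isProbabilityMeasure_stationaryNoise one_pos one_pos
  have := isProbabilityMeasure_expMeasure one_pos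
  refine (MeasurePreserving.id ν).skew_product
    (g := fun α z => dualWeight (directedNoise (α, z)))
    (measurable_dualWeight.comp measurable_directedNoise) ?_
  filter_upwards [hν] with α hα
  obtain ⟨hp, hq, hpq, -⟩ := rates_spec hα
  exact ((measurePreserving_dualWeight hp hq hpq).comp (measurePreserving_rescale hp hq)).map_eq

lemma measurable_deviation_greedy (n : ℕ) :
    Measurable fun y : ℝ × Noise => deviation y.1 (greedy (directedNoise y) n) n := by
  have hg : Measurable fun y : ℝ × Noise => ((greedy (directedNoise y) n).1 : ℝ) :=
    measurable_from_top.comp ((measurable_greedy n).comp measurable_directedNoise).fst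
  unfold deviation
  fun_prop

lemma ae_tendsto_deviation_greedy {ν : Measure ℝ}
    (hν : ∀ᵐ α ∂ν, α ∈ Set.Ioo 0 (Real.pi / 2)) :
    ∀ᵐ y ∂(ν.prod (stationaryNoise 1 1)),
      Tendsto (fun n => deviation y.1 (greedy (directedNoise y) n) n) atTop (𝓝 0) := by
  have := isProbabilityMeasure_stationaryNoise one_pos one_pos
  have hms : MeasurableSet {y : ℝ × Noise |
      Tendsto (fun n => deviation y.1 (greedy (directedNoise y) n) n) atTop (𝓝 0)} :=
    measurableSet_tendsto (𝓝 0) measurable_deviation_greedy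
  rw [Measure.ae_prod_iff_ae_ae hms]
  filter_upwards [hν] with α hα
  obtain ⟨hp, hq, hpq, hcos⟩ := rates_spec hα
  filter_upwards [(measurePreserving_rescale hp hq).quasiMeasurePreserving.ae
    (ae_tendsto_greedy hp hq hpq)] with z hz
  have h := (hz.mul_const (Real.cos α + Real.sin α)).sub_const (Real.cos α)
  rw [hcos, sub_self] at h
  exact h

/-- The walk `s` is a geodesic of the environment `y.2` whose deviation from the direction `y.1` is
at most `1 / (j + 1)` from time `N j` on, for every `j`. The prescribed rate `N` makes this a closed
condition on `y` and `s`. -/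
def IsDirectedGeodesicWalk (N : ℕ → ℕ) (y : ℝ × (ℕ → ℕ → ℝ)) (s : ℕ → Bool) : Prop :=
  IsGeodesicWalk y.2 s ∧ ∀ j n, N j ≤ n → |deviation y.1 (walk s n) n| ≤ 1 / ((j : ℝ) + 1)

lemma isClosed_isDirectedGeodesicWalk (N : ℕ → ℕ) :
    IsClosed {x : (ℝ × (ℕ → ℕ → ℝ)) × (ℕ → Bool) | IsDirectedGeodesicWalk N x.1 x.2} := by
  have hwalk : ∀ n, Continuous fun x : (ℝ × (ℕ → ℕ → ℝ)) × (ℕ → Bool) => walk x.2 n :=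
    fun n => (continuous_walk n).comp continuous_snd
  have hweight : ∀ f : (ℕ → Bool) → ℕ × ℕ, Continuous f →
      Continuous fun x : (ℝ × (ℕ → ℕ → ℝ)) × (ℕ → Bool) => Function.uncurry x.1.2 (f x.2) :=
    fun f hf => (continuous_uncurry_comp hf).comp
      ((continuous_snd.comp continuous_fst).prodMk continuous_snd)
  refine IsClosed.and ?_ ?_
  · simp only [IsGeodesicWalk, Set.ofPred_forall]
    refine isClosed_iInter fun m => isClosed_iInter fun n => isClosed_iInter fun s' => ?_
    refine isClosed_imp ?_ (isClosed_le ?_ ?_)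
    · exact IsOpen.preimage ((hwalk m).prodMk (hwalk (m + n)))
        (isOpen_discrete {z : (ℕ × ℕ) × (ℕ × ℕ) | z.1 + walk s' n = z.2})
    · refine continuous_finsetSum _ fun k _ => hweight (fun s => walk s m + walk s' k) ?_
      exact (continuous_of_discreteTopology (f := fun x : ℕ × ℕ => x + walk s' k)).comp
        (continuous_walk m)
    · exact continuous_finsetSum _ fun k _ => hweight _ (continuous_walk (m + k))
  · simp only [Set.ofPred_forall]
    refine isClosed_iInter fun j => isClosed_iInter fun n => isClosed_iInter fun _ => ?_
    refine isClosed_le (Continuous.abs ?_) continuous_const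
    have h1 : Continuous fun x : (ℝ × (ℕ → ℕ → ℝ)) × (ℕ → Bool) => ((walk x.2 n).1 : ℝ) :=
      (continuous_of_discreteTopology (f := fun k : ℕ => (k : ℝ))).comp (hwalk n).fst
    unfold deviation
    fun_prop

/-- The pairs of a direction and an environment with a directed geodesic walk through `v`. -/
def throughSet (N : ℕ → ℕ) (v : ℕ × ℕ) : Set (ℝ × (ℕ → ℕ → ℝ)) :=
  {y | ∃ s, IsDirectedGeodesicWalk N y s ∧ walk s (v.1 + v.2) = v}

lemma measurableSet_throughSet (N : ℕ → ℕ) (v : ℕ × ℕ) : MeasurableSet (throughSet N v) := by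
  have hcl := (isClosed_isDirectedGeodesicWalk N).and
    (isClosed_eq ((continuous_walk (v.1 + v.2)).comp continuous_snd)
      (continuous_const (y := v)))
  have := (isClosedMap_fst_of_compactSpace _ hcl).measurableSet
  convert! this using 1
  ext y
  simp [throughSet]

lemma measurableSet_exists_isDirectedGeodesicWalk (N : ℕ → ℕ) :
    MeasurableSet {y | ∃ s, IsDirectedGeodesicWalk N y s} := by
  have := (isClosedMap_fst_of_compactSpace _ (isClosed_isDirectedGeodesicWalk N)).measurableSet
  convert! this using 1
  ext y
  simp

/-- With positive probability, i.i.d. exponential weights have a geodesic from the origin in a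
random direction: outside an event of probability at most `1 / 2` the greedy walk converges to its
direction at a deterministic rate, and the existence of a geodesic with this rate is an event
in terms of the direction and the weights alone. -/
lemma exists_measure_isDirectedGeodesicWalk_pos {ν : Measure ℝ} [IsProbabilityMeasure ν]
    (hν : ∀ᵐ α ∂ν, α ∈ Set.Ioo 0 (Real.pi / 2)) :
    ∃ N : ℕ → ℕ, 0 < (ν.prod quadrantLaw) {y | ∃ s, IsDirectedGeodesicWalk N y s} := by
  have := isProbabilityMeasure_stationaryNoise one_pos one_pos
  obtain ⟨t, htm, ht, hunif⟩ := tendstoUniformlyOn_of_ae_tendsto'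
    (f := fun n (y : ℝ × Noise) => deviation y.1 (greedy (directedNoise y) n) n)
    (g := fun _ => 0) (fun n => (measurable_deviation_greedy n).stronglyMeasurable)
    stronglyMeasurable_const (ae_tendsto_deviation_greedy hν) (ε := 1 / 2) (by norm_num)
  rw [Metric.tendstoUniformlyOn_iff] at hunif
  have hrate : ∀ j : ℕ, ∃ n₀ : ℕ, ∀ n, n₀ ≤ n → ∀ y ∈ tᶜ,
      |deviation y.1 (greedy (directedNoise y) n) n| ≤ 1 / ((j : ℝ) + 1) := by
    intro j
    obtain ⟨n₀, hn₀⟩ := eventually_atTop.mp (hunif (1 / ((j : ℝ) + 1)) (by positivity))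
    refine ⟨n₀, fun n hn y hy => ?_⟩
    have := (hn₀ n hn y hy).le
    rwa [dist_comm, dist_zero_right] at this
  choose N hN using hrate
  refine ⟨N, ?_⟩
  rw [← (measurePreserving_directed_dualWeight hν).measure_preimage
    (measurableSet_exists_isDirectedGeodesicWalk N).nullMeasurableSet]
  refine lt_of_lt_of_le ?_ (measure_mono (s := tᶜ) fun y hy => ?_)
  · rw [prob_compl_eq_one_sub htm, tsub_pos_iff_lt]
    refine ht.trans_lt ?_
    rw [ENNReal.ofReal_lt_one]
    norm_num
  · refine ⟨greedySteps (directedNoise y), isGeodesicWalk_greedySteps _, fun j n hn => ?_⟩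
    simp only [walk_greedySteps]
    exact hN j n hn y hy

lemma tsum_indicator_throughSet {N : ℕ → ℕ} {y : ℝ × (ℕ → ℕ → ℝ)} {s : ℕ → Bool}
    (hs : IsDirectedGeodesicWalk N y s) :
    ∑' v, (throughSet N v).indicator (fun _ => (1 : ℝ≥0∞)) y = ∞ := by
  have hinj : Function.Injective (walk s) := fun m n h => by
    rw [← walk_fst_add_snd s m, ← walk_fst_add_snd s n, h]
  rw [eq_top_iff]
  refine le_trans ?_ (ENNReal.tsum_comp_le_tsum_of_injective hinj _)
  have : ∀ n, (throughSet N (walk s n)).indicator (fun _ => (1 : ℝ≥0∞)) y = 1 := fun n =>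
    Set.indicator_of_mem (show y ∈ throughSet N (walk s n) from
      ⟨s, hs, by rw [walk_fst_add_snd]⟩) _
  simp only [this]
  rw [ENNReal.tsum_const_eq_top_of_ne_zero one_ne_zero]

/-- The expected number of vertices on directed geodesics from the origin is infinite. -/
lemma exists_tsum_measure_throughSet_eq_top {ν : Measure ℝ} [IsProbabilityMeasure ν]
    (hν : ∀ᵐ α ∂ν, α ∈ Set.Ioo 0 (Real.pi / 2)) :
    ∃ N : ℕ → ℕ, ∑' v, (ν.prod quadrantLaw) (throughSet N v) = ∞ := by
  obtain ⟨N, hN⟩ := exists_measure_isDirectedGeodesicWalk_pos hν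
  refine ⟨N, ?_⟩
  have hsum : ∑' v, (ν.prod quadrantLaw) (throughSet N v) =
      ∫⁻ y, ∑' v, (throughSet N v).indicator (fun _ => (1 : ℝ≥0∞)) y ∂(ν.prod quadrantLaw) := by
    rw [lintegral_tsum fun v =>
      (measurable_const.indicator (measurableSet_throughSet N v)).aemeasurable]
    refine tsum_congr fun v => ?_
    rw [lintegral_indicator (measurableSet_throughSet N v)]
    simp
  rw [hsum, eq_top_iff]
  calc ∞ = ∞ * (ν.prod quadrantLaw) {y | ∃ s, IsDirectedGeodesicWalk N y s} :=
        (ENNReal.top_mul hN.ne').symm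
    _ = ∫⁻ _ in {y | ∃ s, IsDirectedGeodesicWalk N y s}, ∞ ∂(ν.prod quadrantLaw) := by
        rw [setLIntegral_const]
    _ ≤ ∫⁻ y in {y | ∃ s, IsDirectedGeodesicWalk N y s},
          ∑' v, (throughSet N v).indicator (fun _ => (1 : ℝ≥0∞)) y ∂(ν.prod quadrantLaw) := by
        refine setLIntegral_mono' (measurableSet_exists_isDirectedGeodesicWalk N) ?_
        rintro y ⟨s, hs⟩
        rw [tsum_indicator_throughSet hs]
    _ ≤ _ := setLIntegral_le_lintegral _ _

/-! ### Mass transport -/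

/-- If the environment seen from `-v` has a geodesic through `v`, then the car started at `-v`
passes through the origin. -/
lemma carPasses_of_mem_throughSet {N : ℕ → ℕ} {τ : ℤ × ℤ → ℝ} {α : ℝ} {v : ℕ × ℕ}
    {u : ℤ × ℤ} (huv : site u v = (0, 0)) (hα : α ∈ Set.Ioo 0 (Real.pi / 2))
    (h : (α, fun i j => τ (site u (i, j))) ∈ throughSet N v) : CarPasses τ u α (0, 0) := by
  obtain ⟨s, ⟨hgeo, hdev⟩, hv⟩ := h
  refine ⟨fun n => site u (walk s n), hgeo.isSemiInfiniteGeodesic,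
    hasDirection_of_tendsto hα ?_, v.1 + v.2, by simp only [hv, huv]⟩
  rw [Metric.tendsto_atTop']
  intro ε hε
  obtain ⟨j, hj⟩ := exists_nat_one_div_lt hε
  refine ⟨N j, fun n hn => ?_⟩
  rw [dist_zero_right, Real.norm_eq_abs]
  exact (hdev j n hn.le).trans_lt hj

lemma map_environment {Ω : Type*} [MeasurableSpace Ω] {P : Measure Ω} {τ : ℤ × ℤ → Ω → ℝ}
    (hτ_meas : ∀ v, Measurable (τ v)) (hτ_law : ∀ v, P.map (τ v) = expMeasure 1)
    (hτ_indep : iIndepFun τ P) (u : ℤ × ℤ) :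
    P.map (fun ω i j => τ (site u (i, j)) ω) = quadrantLaw := by
  have := isProbabilityMeasure_expMeasure one_pos
  have hinj : Function.Injective (site u) := by
    intro x y h
    have h1 := congrArg Prod.fst h
    have h2 := congrArg Prod.snd h
    simp only [site] at h1 h2
    ext <;> omega
  have h := (hτ_indep.precomp hinj).map_fun_eq_infinitePi_map fun x => hτ_meas (site u x)
  simp only [hτ_law] at h
  rw [quadrantLaw, ← Measure.infinitePi_map_curry (fun (_ _ : ℕ) => expMeasure 1), ← h,
    Measure.map_map (MeasurableEquiv.measurable _)
      (measurable_pi_iff.mpr fun x => hτ_meas (site u x))]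
  rfl

end RoadLayout

theorem corollary2p1
    {Ω : Type*} [MeasurableSpace Ω] (P : Measure Ω) [IsProbabilityMeasure P]
    (ε : ℝ) (hε : 0 < ε) (hε' : ε < Real.pi / 4)
    -- vertex weights and angles
    (τ θ : ℤ × ℤ → Ω → ℝ)
    (hτ_meas : ∀ v, Measurable (τ v)) (hθ_meas : ∀ v, Measurable (θ v))
    -- the weights are i.i.d. Exp(1)
    (hτ_law : ∀ v, P.map (τ v) = expMeasure 1)
    (hτ_indep : iIndepFun τ P)
    -- the angles are i.i.d. uniform on `(ε, π/2 - ε)`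
    (hθ_law : ∀ v, pdf.IsUniform (θ v) (Set.Ioo ε (Real.pi / 2 - ε)) P volume)
    (hθ_indep : iIndepFun θ P)
    -- the family of weights is independent of the family of angles
    (hτθ_indep : IndepFun (fun ω v => τ v ω) (fun ω v => θ v ω) P) :
    ∫⁻ ω, (RoadLayout.numCars (fun v => τ v ω) (fun v => θ v ω) : ℝ≥0∞) ∂P = ∞ := by
  have hexp := isProbabilityMeasure_expMeasure one_pos
  set ν : Measure ℝ := ProbabilityTheory.cond volume (Set.Ioo ε (Real.pi / 2 - ε)) with hν_def
  have hθν : ∀ v, P.map (θ v) = ν := hθ_law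
  have hνprob : IsProbabilityMeasure ν := by
    rw [← hθν (0, 0)]
    exact Measure.isProbabilityMeasure_map (hθ_meas _).aemeasurable
  have hν : ∀ᵐ α ∂ν, α ∈ Set.Ioo 0 (Real.pi / 2) := by
    filter_upwards [ae_cond_mem (μ := volume) (measurableSet_Ioo (a := ε)
      (b := Real.pi / 2 - ε))] with α hα
    exact ⟨hε.trans hα.1, by linarith [hα.2]⟩
  obtain ⟨N, hN⟩ := RoadLayout.exists_tsum_measure_throughSet_eq_top hν
  -- the car from `start v = -v` sees the origin at displacement `v`
  set start : ℕ × ℕ → ℤ × ℤ := fun v => (-(v.1 : ℤ), -(v.2 : ℤ)) with hstart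
  set Y : ℕ × ℕ → Ω → ℝ × (ℕ → ℕ → ℝ) := fun v ω =>
    (θ (start v) ω, fun i j => τ (RoadLayout.site (start v) (i, j)) ω) with hY
  have henv : ∀ v, Measurable fun ω (i j : ℕ) => τ (RoadLayout.site (start v) (i, j)) ω := fun v =>
    measurable_pi_iff.mpr fun i => measurable_pi_iff.mpr fun j => hτ_meas _
  have hYm : ∀ v, Measurable (Y v) := fun v => (hθ_meas _).prodMk (henv v)
  have hYlaw : ∀ v, P.map (Y v) = ν.prod RoadLayout.quadrantLaw := by
    intro v
    have hind : IndepFun (θ (start v))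
        (fun ω (i j : ℕ) => τ (RoadLayout.site (start v) (i, j)) ω) P :=
      (hτθ_indep.comp (φ := fun (f : ℤ × ℤ → ℝ) (i j : ℕ) => f (RoadLayout.site (start v) (i, j)))
        (ψ := fun (f : ℤ × ℤ → ℝ) => f (start v)) (by fun_prop) (by fun_prop)).symm
    rw [hY, (indepFun_iff_map_prod_eq_prod_map_map (hθ_meas _).aemeasurable
      (henv v).aemeasurable).mp hind, hθν, RoadLayout.map_environment hτ_meas hτ_law hτ_indep]
  have hangle : ∀ᵐ ω ∂P, ∀ v, θ v ω ∈ Set.Ioo 0 (Real.pi / 2) := by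
    rw [ae_all_iff]
    intro v
    refine ae_of_ae_map (hθ_meas v).aemeasurable ?_
    rw [hθν]
    exact hν
  have hstart_inj : Function.Injective start := by
    intro x y h
    simp only [hstart, Prod.mk.injEq] at h
    ext <;> omega
  rw [eq_top_iff]
  calc ∞ = ∑' v, (ν.prod RoadLayout.quadrantLaw) (RoadLayout.throughSet N v) := hN.symm
    _ = ∑' v, ∫⁻ ω, (Y v ⁻¹' RoadLayout.throughSet N v).indicator (fun _ => (1 : ℝ≥0∞)) ω ∂P := by
        refine tsum_congr fun v => ?_
        rw [lintegral_indicator (hYm v (RoadLayout.measurableSet_throughSet N v)), ← hYlaw v,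
          Measure.map_apply (hYm v) (RoadLayout.measurableSet_throughSet N v)]
        simp
    _ = ∫⁻ ω, ∑' v, (Y v ⁻¹' RoadLayout.throughSet N v).indicator (fun _ => (1 : ℝ≥0∞)) ω ∂P :=
        (lintegral_tsum fun v => (measurable_const.indicator
          (hYm v (RoadLayout.measurableSet_throughSet N v))).aemeasurable).symm
    _ ≤ ∫⁻ ω, (RoadLayout.numCars (fun v => τ v ω) (fun v => θ v ω) : ℝ≥0∞) ∂P := by
        -- monotonicity does not need `numCars` to be measurable
        refine lintegral_mono_ae ?_
        filter_upwards [hangle] with ω hω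
        have hcount : ∑' v, (Y v ⁻¹' RoadLayout.throughSet N v).indicator (fun _ => (1 : ℝ≥0∞)) ω =
            ({v | Y v ω ∈ RoadLayout.throughSet N v}.encard : ℝ≥0∞) := by
          rw [← ENNReal.tsum_set_one,
            tsum_subtype {v | Y v ω ∈ RoadLayout.throughSet N v} fun _ => (1 : ℝ≥0∞)]
          rfl
        rw [hcount, RoadLayout.numCars, ← hstart_inj.encard_image]
        gcongr
        rintro _ ⟨v, hv, rfl⟩
        exact RoadLayout.carPasses_of_mem_throughSet (v := v) (by simp [RoadLayout.site, hstart])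
          (hω _) hv
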